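/- **Conventions.** A left brace is a set $G$ with an abelian group structure $(G,+)$ and a group structure $(G,\cdot)$ such that $x\cdot(y+z)+x=x\cdot y+x\cdot z$. Put $\lambda_x(y)=x\cdot y-x$; this gives a morphism $\lambda:(G,\cdot)\to\operatorname{Aut}(G,+)$, whose kernel is the socle $\operatorname{Soc}(G)$. Orbits and stabilizers in $G$ refer to this action. A solution of the Yang–Baxter equation (YBE) is a map $r:Z\times Z\to Z\times Z$, $r(x,y)=(\sigma_x(y),\gamma_y(x))$, with $r_{12}r_{23}r_{12}=r_{23}r_{12}r_{23}$, $r^2=\mathrm{id}$ and all $\sigma_x,\gamma_y$ bijective. Its structure group $G(Z,r)=\langle z\in Z\mid xy=\sigma_x(y)\gamma_y(x)\rangle$ carries the homomorphism $g\mapsto(\pi(g),\phi(g))\in\mathbb Z^{(Z)}\rtimes\operatorname{Sym}_Z$ with $z\mapsto(z,\sigma_z)$, where $\pi$ is bijective. Its permutation group $\mathcal G(Z,r)=\phi(G(Z,r))$ is a left brace with $\phi(g)+\phi(h)=\phi(k)$ where $\pi(k)=\pi(g)+\pi(h)$. A *datum* over a left brace $G$ consists of distinct orbits $X_i$ ($i\in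 I$) whose union $X$ generates $(G,+)$, elements $x_i\in X_i$, and for each $i$ a nonempty family $(K_{i,j})_{j\in J_i}$ of subgroups of the stabilizer $H_i$ of $x_i$ in $(G,\cdot)$, such that the intersection of the cores of all $K_{i,j}$ in $G$ is trivial. It defines, on the disjoint union $Y$ of the coset sets $G/K_{i,j}$, the map $s(y_1,y_2)=(f_{y_1}(y_2),f_{f_{y_1}(y_2)}^{-1}(y_1))$ with $f_{g_1K_{i_1,j_1}}(g_2K_{i_2,j_2})=\lambda_{g_1}(x_{i_1})\cdot g_2K_{i_2,j_2}$. The datum is *basic* if no $K_{i,j}$ can be taken out (together with $X_i$, if it is the only subgroup attached to $X_i$), and no $K_{i,j}$ can be replaced by a strictly larger subgroup of $H_i$, so that the result is still a datum. A *basic solution* associated with $G$ is a solution of the YBE with permutation group isomorphic to $G$ as a left brace that is isomorphic to the $(Y,s)$ of a basic datum. **Statement.** Let $p$ be a prime, $n\ge3$, $1\le i\le n$, and $i\ge2$ if $p=2$. Let $G_i$ be the left brace on $\mathbb Z/(p^n)$ with the usual sum and $x\cdot y=x+y+p^ixy$; ring products are written without a dot. Then: 1. $(G_i,\cdot)$ is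 cyclic of order $p^n$. 2. $\operatorname{Soc}(G_i)=\langle p^{n-i}\rangle$ (additively and multiplicatively generated), and it is isomorphic to $\mathbb Z/(p^i)$ for both operations. 3. The brace automorphisms of $G_i$ are the multiplications by units $1+p^{n-i}k$, $k\in\mathbb Z/(p^n)$: for $i<n$, $\operatorname{Aut}(G_i,+,\cdot)\cong\{1+p^{n-i}k\}\le(\mathbb Z/(p^n))^*$, and $\operatorname{Aut}(G_n,+,\cdot)=\operatorname{Aut}(G_n,+)\cong(\mathbb Z/(p^n))^*$. 4. $\lambda_x(a)=(1+p^ix)a$, and the orbits are exactly the sets (a) $X^{(1)}_\alpha=\{\alpha+p^ix: x\in\mathbb Z/(p^n)\}$, $\alpha\in\{1,\dots,p^i\}$, $p\nmid\alpha$; (b) $X^{(2)}_{\beta p^k}=\{\beta p^k+p^{i+k}x: x\in\mathbb Z/(p^n)\}$, $\beta\in\{1,\dots,p^i\}$, $p\nmid\beta$, $k\in\{1,\dots,n-i-1\}$; (c) $X^{(3)}_{p^{n-i}\gamma}=\{p^{n-i}\gamma\}$, $\gamma\in\{0,\dots,p^i-1\}$. They have $p^{n-i}$, $p^{n-i-k}$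 and $1$ elements, and the stabilizer of any element is, respectively, the unique subgroup of $(G_i,\cdot)$ of order $p^i$, the unique one of order $p^{i+k}$, and $G_i$. 5. The basic data over $G_i$ are exactly those of the following three types, and for all parameters in the ranges of 4 (with the restriction in type 2) such data exist: Type 1: one orbit $X_1=X^{(1)}_\alpha$ with the single subgroup $K_{1,1}=0$; Type 2: two orbits $X_1=X^{(3)}_{p^{n-i}\gamma}$, $X_2=X^{(1)}_\alpha$ with the single subgroups $K_{1,1}=0$, $K_{2,1}=\langle p^{n-i}\rangle$, where $p\mid\gamma$ if $i=n$; Type 3: two orbits $X_1=X^{(2)}_{\beta p^k}$, $X_2=X^{(1)}_\alpha$ with the single subgroups $K_{1,1}=0$, $K_{2,1}=\langle p^{n-i}\rangle$. Consequently the basic solutions associated with $G_i$ are exactly the maps isomorphic to the $(Y,s)$ of a datum of one of these types; in particular each such $(Y,s)$ is a solution of the YBE with permutation group isomorphic to $G_i$ as a left brace. 6. The solutions given by two data of these types, with invariant subsets $X$ and $X'$, are isomorphic if and only if the data are of the same type and $X'=(1+p^{n-i}k)X$ for some $k\in\mathbb Z/(p^n)$. -/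

import Mathlib

universe u v w

/-! ### Left braces -/

/-- A left brace: an abelian group `(G, +)` and a group `(G, *)` on the same set with
`x * (y + z) + x = x * y + x * z`. -/
class LeftBrace (G : Type u) extends AddCommGroup G, Group G where
  brace_axiom : ∀ x y z : G, x * (y + z) + x = x * y + x * z

namespace LeftBrace

variable {G : Type u} [LeftBrace G]

theorem one_eq_zero : (1 : G) = 0 := by
  have h := brace_axiom (1 : G) 0 0
  simpa using h

theorem mul_sub' (x y z : G) : x * (y - z) = x * y - x * z + x := by
  have h := brace_axiom x (y - z) z
  rw [sub_add_cancel] at h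
  rw [sub_add_eq_add_sub, h]
  abel

theorem lam_aux (x y z : G) : x * (y * z - y) - x = x * y * z - x * y := by
  rw [mul_sub', mul_assoc]; abel

/-- The additive automorphism `lam x y = x * y - x`. -/
def lam (x : G) : G ≃+ G where
  toFun y := x * y - x
  invFun y := x⁻¹ * y - x⁻¹
  left_inv y := by simp [lam_aux, one_eq_zero]
  right_inv y := by simp [lam_aux, one_eq_zero]
  map_add' y z := by
    have h := brace_axiom x y z
    rw [eq_sub_of_add_eq h]; abel

theorem lam_mul (x y z : G) : lam (x * y) z = lam x (lam y z) := (lam_aux x y z).symm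

theorem lam_one (z : G) : lam 1 z = z := by simp [lam, one_eq_zero]

variable (G) in
/-- The morphism `lam : (G, *) → Aut(G, +)`; the group operation of `Multiplicative (AddAut G)` is
the composition of automorphisms. -/
def lamHom : G →* Multiplicative (AddAut G) where
  toFun x := Multiplicative.ofAdd (lam x)
  map_one' := congrArg Multiplicative.ofAdd (AddEquiv.ext lam_one)
  map_mul' x y := congrArg Multiplicative.ofAdd (AddEquiv.ext (lam_mul x y))

variable (G) in
/-- The socle: the kernel of `lamHom`, a subgroup of `(G, *)`. -/
def socle : Subgroup G := (lamHom G).ker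

/-- The orbit of `a` under the action `lam` of `(G, *)`. -/
def orbit (a : G) : Set G := Set.range fun g : G => lam g a

/-- The stabilizer of `a` under the action `lam`, a subgroup of `(G, *)`. -/
def stab (a : G) : Subgroup G where
  carrier := {g | lam g a = a}
  mul_mem' {g h} (hg : lam g a = a) (hh : lam h a = a) :=
    show lam (g * h) a = a by rw [lam_mul, hh, hg]
  one_mem' := lam_one a
  inv_mem' {g} (hg : lam g a = a) := show lam g⁻¹ a = a by
    have h := lam_mul g⁻¹ g a
    rwa [inv_mul_cancel, lam_one, hg, eq_comm] at h

variable (G) in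
/-- The group of brace automorphisms of `G`, that is, bijections respecting both operations. -/
def braceAut : Subgroup (MulAut G) where
  carrier := {f | ∀ x y : G, f (x + y) = f x + f y}
  mul_mem' {f g} hf hg := fun x y => by
    rw [MulAut.mul_apply, hg, hf]; rfl
  one_mem' := fun _ _ => rfl
  inv_mem' {f} hf := fun x y => by
    apply f.injective
    rw [hf]
    simp

end LeftBrace

/-! ### Solutions of the Yang-Baxter equation -/

namespace YangBaxter

/-- `r` acting on the first two components of `X × X × X`. -/
def r12 {X : Type w} (r : X × X → X × X) (t : X × X × X) : X × X × X :=
  ((r (t.1, t.2.1)).1, (r (t.1, t.2.1)).2, t.2.2)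

/-- `r` acting on the last two components of `X × X × X`. -/
def r23 {X : Type w} (r : X × X → X × X) (t : X × X × X) : X × X × X :=
  (t.1, r t.2)

/-- Non-degenerate involutive set-theoretic solutions of the Yang-Baxter (braid) equation. Here
`r (x, y) = (σ_x y, γ_y x)`. -/
structure IsSolution {X : Type w} (r : X × X → X × X) : Prop where
  braid : r12 r ∘ r23 r ∘ r12 r = r23 r ∘ r12 r ∘ r23 r
  involutive : r ∘ r = id
  bijective_sigma : ∀ x, Function.Bijective fun y => (r (x, y)).1
  bijective_gamma : ∀ y, Function.Bijective fun x => (r (x, y)).2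

/-- Isomorphism of set-theoretic solutions. -/
def Isomorphic {X : Type v} {Y : Type w} (r : X × X → X × X) (s : Y × Y → Y × Y) : Prop :=
  ∃ f : X ≃ Y, ∀ x y : X, s (f x, f y) = Prod.map f f (r (x, y))

section StructureGroup

variable {X : Type w} {r : X × X → X × X}

/-- The relations `x y = σ_x(y) γ_y(x)` of the structure group. -/
def relations (r : X × X → X × X) : Set (FreeGroup X) :=
  {w | ∃ x y : X, w = FreeGroup.of x * FreeGroup.of y *
    (FreeGroup.of (r (x, y)).1 * FreeGroup.of (r (x, y)).2)⁻¹}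

/-- The structure group `G(X, r) = ⟨x ∈ X ∣ x y = σ_x(y) γ_y(x)⟩`. -/
abbrev StructureGroup (r : X × X → X × X) : Type w := PresentedGroup (relations r)

/-- The permutation `σ_x`. -/
noncomputable def sigma (hr : IsSolution r) (x : X) : Equiv.Perm X :=
  Equiv.ofBijective _ (hr.bijective_sigma x)

/-- The action of `Sym_X` on the free abelian group with basis `X`, written multiplicatively. -/
noncomputable def permAction (X : Type w) :
    Equiv.Perm X →* MulAut (Multiplicative (X →₀ ℤ)) where
  toFun f := AddEquiv.toMultiplicative (Finsupp.domCongr f)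
  map_one' := by ext a x; rfl
  map_mul' f g := by ext a x; rfl

/-- The semidirect product of the free abelian group on `X` by `Sym_X`. -/
abbrev FreeSemidirect (X : Type w) : Type w :=
  Multiplicative (X →₀ ℤ) ⋊[permAction X] Equiv.Perm X

/-- The element `(x, σ_x)`. -/
noncomputable def generator (hr : IsSolution r) (x : X) : FreeSemidirect X :=
  ⟨Multiplicative.ofAdd (Finsupp.single x 1), sigma hr x⟩

theorem generator_relation (hr : IsSolution r) (x y : X) :
    generator hr x * generator hr y =
      generator hr (r (x, y)).1 * generator hr (r (x, y)).2 := by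
  have key : sigma hr (r (x, y)).1 (r (x, y)).2 = x := by
    have h := congrFun hr.involutive (x, y)
    exact congrArg Prod.fst h
  have act : ∀ (f : Equiv.Perm X) (z : X),
      permAction X f (Multiplicative.ofAdd (Finsupp.single z 1)) =
        Multiplicative.ofAdd (Finsupp.single (f z) 1) := by
    intro f z
    exact congrArg Multiplicative.ofAdd (Finsupp.equivMapDomain_single f z (1 : ℤ))
  ext1
  · change Multiplicative.ofAdd (Finsupp.single x (1 : ℤ)) *
        permAction X (sigma hr x) (Multiplicative.ofAdd (Finsupp.single y 1)) =
      Multiplicative.ofAdd (Finsupp.single (r (x, y)).1 (1 : ℤ)) *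
        permAction X (sigma hr (r (x, y)).1)
          (Multiplicative.ofAdd (Finsupp.single (r (x, y)).2 1))
    rw [act, act, key, mul_comm]
    rfl
  · ext z
    have h := congrFun hr.braid (x, y, z)
    exact (congrArg Prod.fst h).symm

/-- The homomorphism `g ↦ (π g, φ g)` extending `x ↦ (x, σ_x)`. -/
noncomputable def toSemidirect (hr : IsSolution r) : StructureGroup r →* FreeSemidirect X :=
  PresentedGroup.toGroup (f := generator hr) (by
    rintro _ ⟨x, y, rfl⟩
    simp only [map_mul, map_inv, FreeGroup.lift_apply_of]
    rw [mul_inv_eq_one]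
    exact generator_relation hr x y)

/-- The bijective 1-cocycle `π : G(X, r) → ℤ^(X)`. -/
noncomputable def cocycle (hr : IsSolution r) (g : StructureGroup r) : X →₀ ℤ :=
  Multiplicative.toAdd (toSemidirect hr g).left

/-- The homomorphism `φ : G(X, r) → Sym_X`. -/
noncomputable def phi (hr : IsSolution r) : StructureGroup r →* Equiv.Perm X :=
  SemidirectProduct.rightHom.comp (toSemidirect hr)

/-- The permutation group, the image of `φ`; it is generated by the `σ_x`. -/
noncomputable def permutationGroup (hr : IsSolution r) : Subgroup (Equiv.Perm X) :=
  (phi hr).range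

/-- The permutation group of `(X, r)` is isomorphic to `G` as a left brace. The sum of the
permutation group is `φ g + φ h = φ (g + h)`, where the sum `k = g + h` in the structure group is
determined by `π k = π g + π h`. -/
def PermutationBraceIso (G : Type u) [LeftBrace G] (hr : IsSolution r) : Prop :=
  ∃ e : permutationGroup hr ≃* G, ∀ g h k : StructureGroup r,
    cocycle hr k = cocycle hr g + cocycle hr h →
      e ((phi hr).rangeRestrict k) =
        e ((phi hr).rangeRestrict g) + e ((phi hr).rangeRestrict h)

end StructureGroup

/-! ### Solutions built from a left brace -/

/-- The input of the construction: representatives `x i` of the pairwise distinct orbits `X_i` of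
a `lam`-invariant subset generating `(G, +)`, and for each `i` a nonempty family of subgroups
`K i j` of the stabilizer of `x i` such that the cores of all the `K i j` intersect trivially. -/
structure Datum (G : Type u) [LeftBrace G] where
  I : Type v
  x : I → G
  orbit_injective : Function.Injective fun i => LeftBrace.orbit (x i)
  J : I → Type v
  nonempty_J : ∀ i, Nonempty (J i)
  K : ∀ i, J i → Subgroup G
  K_le_stab : ∀ i j, K i j ≤ LeftBrace.stab (x i)
  generates : AddSubgroup.closure (⋃ i, LeftBrace.orbit (x i)) = ⊤
  core_eq_bot : ⨅ i, ⨅ j, (K i j).normalCore = ⊥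

namespace Datum

variable {G : Type u} [LeftBrace G] (D : Datum.{u, v} G)

/-- The invariant subset `X`, the union of the orbits `X_i`. -/
def X : Set G := ⋃ i, LeftBrace.orbit (D.x i)

/-- The set `Y`: the disjoint union of the sets of left cosets `G / K i j`. -/
abbrev Y : Type (max u v) := Σ i : D.I, Σ j : D.J i, G ⧸ D.K i j

/-- The map `Y → G` sending the coset `g K i j` to `lam g (x i)`. -/
def value (y : D.Y) : G :=
  Quotient.liftOn' y.2.2 (fun g => LeftBrace.lam g (D.x y.1)) (by
    intro a b hab
    have h : a⁻¹ * b ∈ D.K y.1 y.2.1 := QuotientGroup.leftRel_apply.mp hab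
    have h' : LeftBrace.lam (a⁻¹ * b) (D.x y.1) = D.x y.1 := D.K_le_stab _ _ h
    have h'' := congrArg (LeftBrace.lam a) h'
    rw [← LeftBrace.lam_mul, mul_inv_cancel_left] at h''
    exact h''.symm)

/-- The solution `s (y₁, y₂) = (f_{y₁}(y₂), f_{f_{y₁}(y₂)}⁻¹(y₁))` on `Y`, where
`f_{g₁ K}(g₂ K') = lam g₁ (x i₁) * g₂ K'`. -/
def solution (q : D.Y × D.Y) : D.Y × D.Y :=
  (D.value q.1 • q.2, (D.value (D.value q.1 • q.2))⁻¹ • q.1)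

/-- The datum is basic: no `K i j` can be taken out (together with `X_i`, if it was the only
subgroup attached to `X_i`), and no `K i j` can be replaced by a strictly larger subgroup of the
stabilizer of `x i`, without losing one of the requirements of the construction. -/
structure IsBasic : Prop where
  not_removable : ∀ (i : D.I) (j : D.J i),
    ¬ (AddSubgroup.closure
          (⋃ (q : Σ i, D.J i) (_ : q ≠ ⟨i, j⟩), LeftBrace.orbit (D.x q.1)) = ⊤ ∧
        ⨅ (q : Σ i, D.J i) (_ : q ≠ ⟨i, j⟩), (D.K q.1 q.2).normalCore = ⊥)
  not_enlargeable : ∀ (i : D.I) (j : D.J i) (K' : Subgroup G),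
    D.K i j < K' → K' ≤ LeftBrace.stab (D.x i) →
      K'.normalCore ⊓
        ⨅ (q : Σ i, D.J i) (_ : q ≠ ⟨i, j⟩), (D.K q.1 q.2).normalCore ≠ ⊥

/-- The datum consists of one orbit `S` and one subgroup `L`. -/
def IsSingle (S : Set G) (L : Subgroup G) : Prop :=
  ∃ (i : D.I) (j : D.J i), (∀ q : Σ i, D.J i, q = ⟨i, j⟩) ∧
    LeftBrace.orbit (D.x i) = S ∧ D.K i j = L

/-- The datum consists of two distinct orbits `S₁`, `S₂`, with one subgroup for each of them,
`L₁` for `S₁` and `L₂` for `S₂`. -/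
def IsPair (S₁ : Set G) (L₁ : Subgroup G) (S₂ : Set G) (L₂ : Subgroup G) : Prop :=
  ∃ (i₁ : D.I) (j₁ : D.J i₁) (i₂ : D.I) (j₂ : D.J i₂), i₁ ≠ i₂ ∧
    (∀ q : Σ i, D.J i, q = ⟨i₁, j₁⟩ ∨ q = ⟨i₂, j₂⟩) ∧
    LeftBrace.orbit (D.x i₁) = S₁ ∧ D.K i₁ j₁ = L₁ ∧
    LeftBrace.orbit (D.x i₂) = S₂ ∧ D.K i₂ j₂ = L₂

end Datum

/-- `(Z, t)` is a basic solution associated with the left brace `G`: a solution with permutation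
group isomorphic to `G` as a left brace which is given by a basic datum. -/
def IsBasicSolution (G : Type u) [LeftBrace G] {Z : Type w} (t : Z × Z → Z × Z) : Prop :=
  (∃ ht : IsSolution t, PermutationBraceIso G ht) ∧
    ∃ D : Datum.{u, w} G, D.IsBasic ∧ Isomorphic t D.solution

end YangBaxter

/-! ### The braces `G_i` on `ℤ/(p^n)` -/

/-- The set `ℤ/(p^n)`, as underlying set of the left brace `G_i`. -/
def CyclicBrace (p n _i : ℕ) : Type := ZMod (p ^ n)

namespace CyclicBrace

variable {p n i : ℕ}

/-- The identity map from `G_i` to the ring `ℤ/(p^n)`. -/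
def toZMod : CyclicBrace p n i ≃ ZMod (p ^ n) := Equiv.refl _

instance : AddCommGroup (CyclicBrace p n i) := inferInstanceAs (AddCommGroup (ZMod (p ^ n)))

theorem isUnit_aux [NeZero i] (x : ZMod (p ^ n)) : IsUnit (1 + (p : ZMod (p ^ n)) ^ i * x) := by
  apply IsNilpotent.isUnit_one_add
  refine ⟨n, ?_⟩
  have h : (p : ZMod (p ^ n)) ^ n = 0 := by
    have h' := ZMod.natCast_self (p ^ n)
    push_cast at h'
    exact h'
  rw [mul_pow, ← pow_mul, mul_comm i n, pow_mul, h, zero_pow (NeZero.ne i), zero_mul]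

/-- The left brace `G_i`: the sum is that of `ℤ/(p^n)` and the product is
`x · y = x + y + p^i x y`. -/
instance [NeZero i] : LeftBrace (CyclicBrace p n i) where
  mul x y := toZMod.symm (toZMod x + toZMod y + (p : ZMod (p ^ n)) ^ i * toZMod x * toZMod y)
  one := toZMod.symm 0
  inv x := toZMod.symm (-toZMod x * (1 + (p : ZMod (p ^ n)) ^ i * toZMod x)⁻¹)
  mul_assoc x y z := by
    change toZMod.symm ((toZMod x + toZMod y + (p : ZMod (p ^ n)) ^ i * toZMod x * toZMod y) +
        toZMod z + (p : ZMod (p ^ n)) ^ i *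
          (toZMod x + toZMod y + (p : ZMod (p ^ n)) ^ i * toZMod x * toZMod y) * toZMod z) =
      toZMod.symm (toZMod x +
        (toZMod y + toZMod z + (p : ZMod (p ^ n)) ^ i * toZMod y * toZMod z) +
        (p : ZMod (p ^ n)) ^ i * toZMod x *
          (toZMod y + toZMod z + (p : ZMod (p ^ n)) ^ i * toZMod y * toZMod z))
    congr 1
    ring
  one_mul x := by
    change toZMod.symm (0 + toZMod x + _ * 0 * toZMod x) = x
    simp
  mul_one x := by
    change toZMod.symm (toZMod x + 0 + _ * toZMod x * 0) = x
    simp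
  inv_mul_cancel x := by
    have h := ZMod.mul_inv_of_unit _ (isUnit_aux (p := p) (n := n) (i := i) (toZMod x))
    change toZMod.symm (-toZMod x * (1 + (p : ZMod (p ^ n)) ^ i * toZMod x)⁻¹ + toZMod x +
      (p : ZMod (p ^ n)) ^ i * (-toZMod x * (1 + (p : ZMod (p ^ n)) ^ i * toZMod x)⁻¹) *
        toZMod x) = toZMod.symm 0
    congr 1
    linear_combination (-toZMod x) * h
  brace_axiom x y z := by
    change toZMod x + (toZMod y + toZMod z) +
        (p : ZMod (p ^ n)) ^ i * toZMod x * (toZMod y + toZMod z) + toZMod x =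
      (toZMod x + toZMod y + (p : ZMod (p ^ n)) ^ i * toZMod x * toZMod y) +
        (toZMod x + toZMod z + (p : ZMod (p ^ n)) ^ i * toZMod x * toZMod z)
    ring

theorem toZMod_add (x y : CyclicBrace p n i) : toZMod (x + y) = toZMod x + toZMod y := rfl

theorem toZMod_mul [NeZero i] (x y : CyclicBrace p n i) :
    toZMod (x * y) = toZMod x + toZMod y + (p : ZMod (p ^ n)) ^ i * toZMod x * toZMod y := rfl

variable (p n i)

/-- The element `p^(n-i)` of `G_i`. -/
def socGen : CyclicBrace p n i := toZMod.symm ((p : ZMod (p ^ n)) ^ (n - i))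

/-- The multiplicative subgroup `⟨p^(n-i)⟩` of `G_i`. -/
def socSubgroup [NeZero i] : Subgroup (CyclicBrace p n i) := Subgroup.zpowers (socGen p n i)

/-- `{α + p^i x}`. -/
def X1 (α : ℕ) : Set (CyclicBrace p n i) :=
  {a | ∃ x : ZMod (p ^ n), toZMod a = (α : ZMod (p ^ n)) + (p : ZMod (p ^ n)) ^ i * x}

/-- `{β p^k + p^(i+k) x}`. -/
def X2 (β k : ℕ) : Set (CyclicBrace p n i) :=
  {a | ∃ x : ZMod (p ^ n), toZMod a =
    (β : ZMod (p ^ n)) * (p : ZMod (p ^ n)) ^ k + (p : ZMod (p ^ n)) ^ (i + k) * x}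

/-- `{p^(n-i) γ}`. -/
def X3 (γ : ℕ) : Set (CyclicBrace p n i) :=
  {toZMod.symm ((p : ZMod (p ^ n)) ^ (n - i) * (γ : ZMod (p ^ n)))}

/-- Admissible `α`: `α ∈ {1, …, p^i}` with `p ∤ α`. -/
def IsParam1 (α : ℕ) : Prop := 1 ≤ α ∧ α ≤ p ^ i ∧ ¬ p ∣ α

/-- Admissible `(β, k)`: `β ∈ {1, …, p^i}` with `p ∤ β`, and `k ∈ {1, …, n-i-1}`. -/
def IsParam2 (β k : ℕ) : Prop := (1 ≤ β ∧ β ≤ p ^ i ∧ ¬ p ∣ β) ∧ 1 ≤ k ∧ i + k + 1 ≤ n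

/-- Admissible `γ`: `γ ∈ {0, …, p^i - 1}`. -/
def IsParam3 (γ : ℕ) : Prop := γ < p ^ i

variable {p n i} [NeZero i]

/-- Type 1: `X_1 = X1 α` with `K = 0`. -/
def IsType1 (D : YangBaxter.Datum.{0, v} (CyclicBrace p n i)) : Prop :=
  ∃ α : ℕ, IsParam1 p i α ∧ D.IsSingle (X1 p n i α) ⊥

/-- Type 2: `X_1 = X3 γ` with `K = 0` and `X_2 = X1 α` with `K = ⟨p^(n-i)⟩`. The orbit `X3 γ` does
not consist of a unit of `ℤ/(p^n)`, which only excludes something when `i = n`. -/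
def IsType2 (D : YangBaxter.Datum.{0, v} (CyclicBrace p n i)) : Prop :=
  ∃ γ α : ℕ, IsParam3 p i γ ∧ (i = n → p ∣ γ) ∧ IsParam1 p i α ∧
    D.IsPair (X3 p n i γ) ⊥ (X1 p n i α) (socSubgroup p n i)

/-- Type 3: `X_1 = X2 β k` with `K = 0` and `X_2 = X1 α` with `K = ⟨p^(n-i)⟩`. -/
def IsType3 (D : YangBaxter.Datum.{0, v} (CyclicBrace p n i)) : Prop :=
  ∃ β k α : ℕ, IsParam2 p n i β k ∧ IsParam1 p i α ∧
    D.IsPair (X2 p n i β k) ⊥ (X1 p n i α) (socSubgroup p n i)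

end CyclicBrace

/-! The argument has a general half about left braces and an arithmetic half about `ℤ/(p^n)`.

General half. Let `G` act faithfully on `Y`, and let `v : Y → G` be equivariant for `lam` with image
generating `(G, +)`. The map `braceSolution v` is a solution because `a * b = a + lam a b` and the
sum is commutative (`lam_inv_mul_mul`). Its permutation group is `G` as a brace: sending `y` to `v
y` defines a homomorphism from the structure group onto `G`, and the linear extension of `v` to
`ℤ^(Y)` turns the cocycle `π` into this homomorphism. An isomorphism of two such solutions
conjugates the generators `v y` into the generators `v' z`, hence induces a brace automorphism
carrying one invariant subset onto the other. A datum is such a pair `(Y, v)`, and faithfulness of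
the action is the condition on cores.

Arithmetic half. In `G_i`, `lam x` is multiplication by `1 + p^i x`, so orbits, stabilizers and
socle are read off from p-adic valuations. Lifting the exponent shows that the ring element `1`
generates the multiplicative group, which is therefore a cyclic p-group: its nontrivial subgroups
share a nontrivial element, so the cores meet trivially exactly when some `K i j` is trivial.
Dually, a set generates `(G, +)` exactly when it contains a unit. A basic datum must thus provide,
with nothing superfluous, a unit orbit and a trivial subgroup. Either one pair supplies both (type
1), or two pairs share the tasks and maximality gives the unit orbit its full stabilizer, the socle
(types 2 and 3).

Brace automorphisms are the multiplications by units `1 + p^(n-i) k`. They preserve units and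
annihilators, hence the types, and they match the subgroups, which yields the isomorphism criterion.
-/

namespace LeftBrace

variable {G : Type u} [LeftBrace G]

/-! ### Identities in a left brace. -/

theorem lam_apply (a b : G) : lam a b = a * b - a := rfl

theorem mul_eq_add_lam (a b : G) : a * b = a + lam a b := by
  rw [lam_apply]; abel

theorem lam_inv_lam (a b : G) : lam a⁻¹ (lam a b) = b := by
  rw [← lam_mul, inv_mul_cancel, lam_one]

theorem lam_lam_inv (a b : G) : lam a (lam a⁻¹ b) = b := by
  rw [← lam_mul, mul_inv_cancel, lam_one]

theorem mul_lam_inv (a b : G) : a * lam a⁻¹ b = a + b := by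
  rw [mul_eq_add_lam, lam_lam_inv]

theorem inv_eq_neg_lam (a : G) : a⁻¹ = -lam a⁻¹ a := by
  rw [lam_apply, inv_mul_cancel, one_eq_zero]; abel

theorem neg_inv_eq_lam (a : G) : (-a)⁻¹ = lam (-a)⁻¹ a := by
  conv_lhs => rw [inv_eq_neg_lam, map_neg, neg_neg]

/-- By commutativity of the sum, `a * b = lam a b + a = lam a b * lam (lam a b)⁻¹ a`. This is the
relation `x y = σ_x(y) γ_y(x)` at the level of values. -/
theorem lam_inv_mul_mul (a b : G) : (lam a b)⁻¹ * (a * b) = lam (lam a b)⁻¹ a := by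
  rw [inv_mul_eq_iff_eq_mul, mul_lam_inv, mul_eq_add_lam, add_comm]

/-- The additive closure of a `lam`-invariant set is contained in its multiplicative closure. -/
theorem mem_closure_of_mem_addClosure {X : Set G} (hX : ∀ g, ∀ x ∈ X, lam g x ∈ X) {a : G}
    (ha : a ∈ AddSubgroup.closure X) : a ∈ Subgroup.closure X := by
  have hneg : ∀ y ∈ X, -y ∈ Subgroup.closure X := fun y hy => by
    rw [← inv_mem_iff, neg_inv_eq_lam]
    exact Subgroup.subset_closure (hX _ _ hy)
  rw [← AddSubgroup.mem_toAddSubmonoid, AddSubgroup.closure_toAddSubmonoid] at ha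
  -- The summand `s` makes the induction work: `s + x = s * lam s⁻¹ x`, and invariance keeps `lam
  -- s⁻¹ x` in `X`, up to sign.
  suffices h : ∀ s ∈ Subgroup.closure X, s + a ∈ Subgroup.closure X by
    simpa [one_eq_zero] using h 1 (one_mem _)
  induction ha using AddSubmonoid.closure_induction with
  | mem x hx =>
    intro s hs
    rw [← mul_lam_inv]
    refine mul_mem hs ?_
    rcases hx with hx | hx
    · exact Subgroup.subset_closure (hX _ _ hx)
    · simpa using hneg _ (hX s⁻¹ _ hx)
  | zero => simp
  | add x y _ _ hx hy =>
    intro s hs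
    rw [← add_assoc]
    exact hy _ (hx _ hs)

end LeftBrace

/-! ### Solutions attached to an equivariant map from a `G`-set to `G`. -/

namespace YangBaxter

open LeftBrace

variable {G : Type u} [LeftBrace G] {Y : Type v} [MulAction G Y] {Z : Type w} [MulAction G Z]

/-- The map `(y₁, y₂) ↦ (v y₁ • y₂, (v (v y₁ • y₂))⁻¹ • y₁)` attached to a map `v : Y → G`. -/
def braceSolution (v : Y → G) (q : Y × Y) : Y × Y :=
  (v q.1 • q.2, (v (v q.1 • q.2))⁻¹ • q.1)

/-- Equivariance computes the value of every coordinate, so the braid relation becomes equalities of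
group elements acting on `x`, `y`, `z`. These follow from `lam_inv_mul_mul` and commutativity of the
sum. -/
theorem isSolution_braceSolution {v : Y → G} (hv : ∀ g y, v (g • y) = lam g (v y)) :
    IsSolution (braceSolution v) where
  braid := by
    funext ⟨x, y, z⟩
    simp only [r12, r23, braceSolution, Function.comp_apply, hv, smul_smul]
    generalize v x = a
    generalize v y = b
    generalize v z = c
    have h1 : lam a b * lam (lam a b)⁻¹ a = a * b := by
      rw [← lam_inv_mul_mul, mul_inv_cancel_left]
    have h2 : lam (lam (a * b) c)⁻¹ a * (lam b c)⁻¹ = (lam (a * b) c)⁻¹ * a := by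
      rw [lam_mul, ← lam_inv_mul_mul, mul_assoc, mul_assoc, mul_inv_cancel, mul_one]
    refine Prod.ext ?_ (Prod.ext ?_ ?_) <;> simp only
    · rw [h1]
    · rw [h1, h2]
    · rw [h2, ← mul_inv_rev, ← mul_inv_rev, lam_mul (lam (a * b) c)⁻¹ a b, mul_lam_inv,
        mul_eq_add_lam (lam a b), ← lam_mul, h1, add_comm]
  involutive := by
    funext ⟨x, y⟩
    simp [braceSolution, hv, smul_smul]
  bijective_sigma x := MulAction.bijective (v x)
  bijective_gamma y := by
    simp only [braceSolution, hv]
    generalize v y = b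
    constructor
    -- The value `a` of `x` is recovered from `b` and the value of the image. Hence two points with
    -- the same image have the same value and are moved by the same group element.
    · have key : ∀ a : G, (lam b (lam (lam a b)⁻¹ a)⁻¹)⁻¹ = a := fun a => by
        rw [← lam_inv_mul_mul, mul_inv_rev, inv_inv, mul_inv_rev, lam_apply, mul_assoc,
          mul_inv_cancel_left, mul_eq_add_lam, lam_inv_lam, add_sub_cancel_right, inv_inv]
      intro x x' h
      have h' := congrArg v h
      simp only [hv] at h'
      have hx : v x = v x' := by rw [← key (v x), h', key]
      simp only [hx] at h
      exact MulAction.injective _ h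
    · intro w
      -- The inversion formula `key`, applied to the prescribed image `w`, predicts the value of the
      -- preimage.
      set a : G := (lam b (v w)⁻¹)⁻¹ with ha
      have h1 : lam a b * v w = a * b := by
        have h2 : a⁻¹ + b = b * (v w)⁻¹ := by
          rw [ha, inv_inv, mul_eq_add_lam, add_comm]
        rw [← mul_lam_inv, inv_inv] at h2
        rw [eq_mul_inv_iff_mul_eq, mul_assoc] at h2
        exact eq_inv_mul_iff_mul_eq.mpr h2
      have h2 : lam (lam a b) (v w) = a := by
        rw [lam_apply, h1, mul_eq_add_lam, add_sub_cancel_right]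
      refine ⟨lam a b • w, ?_⟩
      simp only [hv, h2, inv_smul_smul]

theorem closure_range_eq_top {v : Y → G} (hv : ∀ g y, v (g • y) = lam g (v y))
    (hgen : AddSubgroup.closure (Set.range v) = ⊤) : Subgroup.closure (Set.range v) = ⊤ := by
  rw [eq_top_iff]
  intro a _
  apply mem_closure_of_mem_addClosure
  · rintro g _ ⟨y, rfl⟩
    exact ⟨g • y, hv g y⟩
  · rw [hgen]; trivial

/-- The map `φ` is the action composed with the surjection `ψ` extending `v`, so by faithfulness the
permutation group is `G`. For sums, let `θ` extend `v` linearly to `ℤ^(Y)`: `θ ∘ π` and `ψ` obey the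
same cocycle identity and agree on generators, so `ψ` is additive wherever `π` is. -/
theorem permutationBraceIso_braceSolution [FaithfulSMul G Y] {v : Y → G}
    (hv : ∀ g y, v (g • y) = lam g (v y)) (hgen : AddSubgroup.closure (Set.range v) = ⊤)
    (hr : IsSolution (braceSolution v)) : PermutationBraceIso G hr := by
  let ψ : StructureGroup (braceSolution v) →* G := PresentedGroup.toGroup (f := v) (by
    rintro _ ⟨x, y, rfl⟩
    simp only [map_mul, map_inv, FreeGroup.lift_apply_of, mul_inv_eq_one]
    simp only [braceSolution, hv]
    rw [← lam_inv_mul_mul, mul_inv_cancel_left])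
  have hψ : ∀ y, ψ (PresentedGroup.of y) = v y := fun y => PresentedGroup.toGroup.of _
  have hsd : ∀ y, toSemidirect hr (PresentedGroup.of y) = generator hr y :=
    fun y => PresentedGroup.toGroup.of _
  have hφ : ∀ g, phi hr g = MulAction.toPermHom G Y (ψ g) := by
    refine DFunLike.congr_fun
      (?_ : phi hr = (MulAction.toPermHom G Y).comp ψ)
    refine PresentedGroup.ext fun y => ?_
    ext z
    simp only [phi, MonoidHom.comp_apply, hsd, hψ]
    rfl
  let θ : (Y →₀ ℤ) →+ G := Finsupp.liftAddHom fun y => zmultiplesHom G (v y)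
  have hθs : ∀ y, θ (Finsupp.single y 1) = v y := fun y => by simp [θ]
  have hθ : ∀ (a : G) (m : Y →₀ ℤ),
      θ (Finsupp.domCongr (MulAction.toPermHom G Y a) m) = lam a (θ m) := by
    intro a m
    refine DFunLike.congr_fun
      (?_ : θ.comp (Finsupp.domCongr (MulAction.toPermHom G Y a)).toAddMonoidHom =
        (lam a).toAddMonoidHom.comp θ) m
    ext y
    simp [θ, hv]
  have hcoc : ∀ g h, cocycle hr (g * h) =
      cocycle hr g + Finsupp.domCongr (phi hr g) (cocycle hr h) := by
    intro g h
    simp only [cocycle, map_mul]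
    rfl
  have hθψ : ∀ g, θ (cocycle hr g) = ψ g := by
    intro g
    have hg : g ∈ Subgroup.closure
        (Set.range (PresentedGroup.of (rels := relations (braceSolution v)))) := by
      rw [PresentedGroup.closure_range_of]; trivial
    have hmul : ∀ g h, θ (cocycle hr g) = ψ g →
        θ (cocycle hr (g * h)) = ψ g + lam (ψ g) (θ (cocycle hr h)) := by
      intro g h hg
      rw [hcoc, map_add, hφ, hθ, hg]
    induction hg using Subgroup.closure_induction with
    | mem x hx =>
      obtain ⟨y, rfl⟩ := hx
      rw [hψ, ← hθs, cocycle, hsd]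
      rfl
    | one =>
      rw [map_one, one_eq_zero]
      simp [cocycle]
    | mul g h _ _ hg hh => rw [hmul _ _ hg, hh, map_mul, mul_eq_add_lam]
    | inv g _ hg =>
      -- The cocycle identity for `g * g⁻¹ = 1` determines the value at `g⁻¹`, since `lam (ψ g)` is
      -- injective.
      have h1 := hmul g g⁻¹ hg
      have h2 := mul_eq_add_lam (ψ g) (ψ g⁻¹)
      rw [← map_mul, mul_inv_cancel] at h2
      rw [mul_inv_cancel] at h1
      have h3 : θ (cocycle hr 1) = ψ 1 := by
        rw [map_one, one_eq_zero]
        simp [cocycle]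
      rw [h3, h2] at h1
      exact ((lam (ψ g)).injective (add_left_cancel h1)).symm
  have hsurj : Function.Surjective ψ := by
    rw [← MonoidHom.range_eq_top, eq_top_iff, ← closure_range_eq_top hv hgen, Subgroup.closure_le]
    rintro _ ⟨y, rfl⟩
    exact ⟨_, hψ y⟩
  have hinj : Function.Injective (MulAction.toPermHom G Y) := MulAction.toPerm_injective
  have hrange : permutationGroup hr = (MulAction.toPermHom G Y).range := by
    have : phi hr = (MulAction.toPermHom G Y).comp ψ := MonoidHom.ext hφ
    rw [permutationGroup, this, MonoidHom.range_comp, MonoidHom.range_eq_top.mpr hsurj,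
      MonoidHom.range_eq_map]
  let e : permutationGroup hr ≃* G :=
    (MulEquiv.subgroupCongr hrange).trans (MonoidHom.ofInjective hinj).symm
  have he : ∀ g, e ((phi hr).rangeRestrict g) = ψ g := by
    intro g
    change (MonoidHom.ofInjective hinj).symm _ = _
    rw [MulEquiv.symm_apply_eq]
    ext1
    exact hφ g
  refine ⟨e, fun g h k hk => ?_⟩
  rw [he, he, he, ← hθψ, ← hθψ, ← hθψ, hk, map_add]

/-- An isomorphism between two solutions of this form induces a brace automorphism. -/
theorem exists_mulEquiv_of_isomorphic [FaithfulSMul G Y] [FaithfulSMul G Z] {v : Y → G}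
    {v' : Z → G} (hv : ∀ g y, v (g • y) = lam g (v y)) (hv' : ∀ g y, v' (g • y) = lam g (v' y))
    (hgen : AddSubgroup.closure (Set.range v) = ⊤)
    (hgen' : AddSubgroup.closure (Set.range v') = ⊤)
    (h : Isomorphic (braceSolution v) (braceSolution v')) :
    ∃ μ : G ≃* G, (∀ a b, μ (a + b) = μ a + μ b) ∧ μ '' Set.range v = Set.range v' := by
  obtain ⟨f, hf⟩ := h
  have hf1 : ∀ x y, f (v x • y) = v' (f x) • f y := fun x y => (congrArg Prod.fst (hf x y)).symm
  let ρ := MulAction.toPermHom G Z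
  -- The action on `Y` is transported to `Z` along `f`. There `v y` and `v' (f y)` act by the same
  -- permutation, so both copies of `G` have the same image in `Sym_Z`, and `μ` compares them.
  let c : G →* Equiv.Perm Z := f.permCongrHom.toMonoidHom.comp (MulAction.toPermHom G Y)
  have hρ : Function.Injective ρ := MulAction.toPerm_injective
  have hc : Function.Injective c := f.permCongrHom.injective.comp MulAction.toPerm_injective
  have hcv : ∀ y, c (v y) = ρ (v' (f y)) := by
    intro y
    ext z
    change f (v y • f.symm z) = v' (f y) • z
    rw [hf1, f.apply_symm_apply]
  have hrange : c.range = ρ.range := by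
    have h1 : c.range = Subgroup.closure (Set.range (c ∘ v)) := by
      rw [MonoidHom.range_eq_map, ← closure_range_eq_top hv hgen, MonoidHom.map_closure,
        Set.range_comp]
    have h2 : ρ.range = Subgroup.closure (Set.range (ρ ∘ v')) := by
      rw [MonoidHom.range_eq_map, ← closure_range_eq_top hv' hgen', MonoidHom.map_closure,
        Set.range_comp]
    rw [h1, h2, ← f.surjective.range_comp (ρ ∘ v')]
    exact congrArg (fun u => Subgroup.closure (Set.range u)) (funext hcv)
  let μ : G ≃* G := (MonoidHom.ofInjective hc).trans
    ((MulEquiv.subgroupCongr hrange).trans (MonoidHom.ofInjective hρ).symm)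
  have hμ : ∀ g, ρ (μ g) = c g := by
    intro g
    have h : MonoidHom.ofInjective hρ (μ g) =
        MulEquiv.subgroupCongr hrange (MonoidHom.ofInjective hc g) :=
      MulEquiv.apply_symm_apply _ _
    exact congrArg Subtype.val h
  have hμv : ∀ y, μ (v y) = v' (f y) := fun y => hρ (by rw [hμ, hcv])
  have hμf : ∀ g y, f (g • y) = μ g • f y := by
    intro g y
    have h := Equiv.congr_fun (hμ g) (f y)
    change μ g • f y = f (g • f.symm (f y)) at h
    rw [h, f.symm_apply_apply]
  refine ⟨μ, fun a b => ?_, ?_⟩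
  -- Additivity is checked on generators, where `a + v y = a * v (a⁻¹ • y)` expresses a sum by the
  -- product and the action, both respected by `μ` and `f`.
  · have hb : b ∈ AddSubgroup.closure (Set.range v) := by rw [hgen]; trivial
    induction hb using AddSubgroup.closure_induction generalizing a with
    | mem x hx =>
      obtain ⟨y, rfl⟩ := hx
      rw [← mul_lam_inv, ← hv, map_mul, hμv, hμf, hv', map_inv, mul_lam_inv, hμv]
    | zero => rw [← one_eq_zero, map_one, one_eq_zero, add_zero, add_zero]
    | add x y _ _ hx hy => rw [← add_assoc, hy, hx, hy x, add_assoc]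
    | neg x _ hx =>
      have h1 := hx (a + -x)
      have h2 := hx (-x)
      rw [neg_add_cancel_right] at h1
      rw [neg_add_cancel, ← one_eq_zero, map_one, one_eq_zero] at h2
      rw [h1, eq_neg_of_add_eq_zero_left h2.symm, add_neg_cancel_right]
  · rw [← Set.range_comp, ← f.surjective.range_comp v']
    exact congrArg Set.range (funext hμv)

/-- A brace automorphism and a compatible bijection give an isomorphism of solutions. -/
theorem isomorphic_of_equivariant {v : Y → G} {v' : Z → G} (μ : G ≃* G) (f : Y ≃ Z)
    (hf : ∀ g y, f (g • y) = μ g • f y) (hvf : ∀ y, v' (f y) = μ (v y)) :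
    Isomorphic (braceSolution v) (braceSolution v') :=
  ⟨f, fun x y => by
    simp only [braceSolution, Prod.map, hvf, hf, map_inv]
    rw [← hf, hvf]⟩

end YangBaxter

namespace LeftBrace

theorem map_lam {G : Type u} [LeftBrace G] (μ : G ≃* G)
    (hμ : ∀ a b, μ (a + b) = μ a + μ b) (a b : G) :
    μ (lam a b) = lam (μ a) (μ b) := by
  have h := hμ a (lam a b)
  rw [← mul_eq_add_lam, map_mul, mul_eq_add_lam] at h
  exact (add_left_cancel h).symm

end LeftBrace

/-! ### Data: coset spaces as faithful `G`-sets. -/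

namespace YangBaxter

open LeftBrace

namespace Datum

variable {G : Type u} [LeftBrace G] (D : Datum.{u, v} G)

theorem value_mk (i : D.I) (j : D.J i) (g : G) :
    D.value ⟨i, j, (g : G ⧸ D.K i j)⟩ = lam g (D.x i) := rfl

theorem value_smul (g : G) (y : D.Y) : D.value (g • y) = lam g (D.value y) := by
  obtain ⟨i, j, a⟩ := y
  induction a using QuotientGroup.induction_on with
  | H a => exact lam_mul g a (D.x i)

theorem solution_eq_braceSolution : D.solution = braceSolution D.value := rfl

theorem range_value : Set.range D.value = D.X := by
  ext a
  simp only [X, Set.mem_iUnion]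
  constructor
  · rintro ⟨⟨i, j, g⟩, rfl⟩
    induction g using QuotientGroup.induction_on with
    | H g => exact ⟨i, g, rfl⟩
  · rintro ⟨i, g, rfl⟩
    obtain ⟨j⟩ := D.nonempty_J i
    exact ⟨⟨i, j, (g : G ⧸ D.K i j)⟩, rfl⟩

theorem closure_range_value : AddSubgroup.closure (Set.range D.value) = ⊤ := by
  rw [range_value]; exact D.generates

/-- The kernel of the action on a disjoint union of coset spaces is the intersection of the cores of
the subgroups. -/
instance faithfulSMul : FaithfulSMul G D.Y := by
  refine ⟨fun {a b} h => ?_⟩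
  have hab : b⁻¹ * a ∈ ⨅ i, ⨅ j, (D.K i j).normalCore := by
    simp only [Subgroup.mem_iInf]
    intro i j c
    have h1 := h ⟨i, j, ((c⁻¹ : G) : G ⧸ D.K i j)⟩
    have h2 : ((b * c⁻¹ : G) : G ⧸ D.K i j) = ((a * c⁻¹ : G) : G ⧸ D.K i j) := by
      have h3 := eq_of_heq (Sigma.mk.inj (eq_of_heq (Sigma.mk.inj h1).2)).2
      exact h3.symm
    rw [QuotientGroup.eq] at h2
    simpa [mul_assoc] using h2
  rw [D.core_eq_bot, Subgroup.mem_bot, inv_mul_eq_one] at hab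
  exact hab.symm

/-- A map isomorphic to the one given by a datum over `G` is a solution whose permutation group is
isomorphic to `G` as a left brace. -/
theorem exists_permutationBraceIso {Z : Type w} {t : Z × Z → Z × Z}
    (h : Isomorphic t D.solution) : ∃ ht : IsSolution t, PermutationBraceIso G ht := by
  obtain ⟨f, hf⟩ := h
  -- With the action transported to `Z`, `t` is itself the map attached to the equivariant `D.value
  -- ∘ f`.
  let _ : MulAction G Z := f.mulAction G
  have hsmul : ∀ (g : G) (z : Z), f (g • z) = g • f z := fun g z => f.apply_symm_apply _
  have : FaithfulSMul G Z := ⟨fun {a b} hab =>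
    FaithfulSMul.eq_of_smul_eq_smul (α := D.Y) fun y => by
      rw [← f.apply_symm_apply y, ← hsmul, hab, hsmul]⟩
  have hv : ∀ (g : G) (z : Z), (D.value ∘ f) (g • z) = lam g ((D.value ∘ f) z) := fun g z => by
    rw [Function.comp_apply, hsmul, value_smul, Function.comp_apply]
  have hgen : AddSubgroup.closure (Set.range (D.value ∘ f)) = ⊤ := by
    rw [f.surjective.range_comp, closure_range_value]
  have ht : t = braceSolution (D.value ∘ f) := by
    funext ⟨x, y⟩
    apply (f.injective.prodMap f.injective)
    rw [← hf, solution_eq_braceSolution]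
    simp only [braceSolution, Prod.map, Function.comp_apply, hsmul]
  subst ht
  exact ⟨isSolution_braceSolution hv, permutationBraceIso_braceSolution hv hgen _⟩

/-- Isomorphic solutions given by data over `G` have invariant subsets which correspond under a
brace automorphism of `G`. -/
theorem exists_mulEquiv_of_isomorphic {D D' : Datum.{u, v} G}
    (h : Isomorphic D.solution D'.solution) :
    ∃ μ : G ≃* G, (∀ a b, μ (a + b) = μ a + μ b) ∧ μ '' D.X = D'.X := by
  rw [← range_value, ← range_value]
  exact YangBaxter.exists_mulEquiv_of_isomorphic D.value_smul D'.value_smul D.closure_range_value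
    D'.closure_range_value h

/-- Data over a brace with commutative product give isomorphic solutions if their orbits and
subgroups correspond under a brace automorphism. -/
theorem isomorphic_of_map_eq (hcomm : ∀ a b : G, a * b = b * a) {D D' : Datum.{u, v} G}
    (μ : G ≃* G) (hμ : ∀ a b, μ (a + b) = μ a + μ b) (e : (Σ i, D.J i) ≃ (Σ i, D'.J i))
    (hK : ∀ q, ∀ a, a ∈ D.K q.1 q.2 ↔ μ a ∈ D'.K (e q).1 (e q).2)
    (hx : ∀ q, μ (D.x q.1) ∈ orbit (D'.x (e q).1)) :
    Isomorphic D.solution D'.solution := by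
  choose g hg using hx
  -- The factor `g q` compensates for `μ (D.x q.1)` being another point of the orbit of the chosen
  -- representative. Commutativity lets right multiplication by it descend to cosets.
  let F (q : Σ i, D.J i) : G ⧸ D.K q.1 q.2 ≃ G ⧸ D'.K (e q).1 (e q).2 :=
    Quotient.congr (μ.toEquiv.trans (Equiv.mulRight (g q))) (by
      intro a b
      change QuotientGroup.leftRel _ a b ↔ QuotientGroup.leftRel _ (μ a * g q) (μ b * g q)
      rw [QuotientGroup.leftRel_apply, QuotientGroup.leftRel_apply, hK, hcomm (μ a), mul_inv_rev,
        hcomm (μ b), mul_assoc, inv_mul_cancel_left, map_mul, map_inv])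
  let f : D.Y ≃ D'.Y := (Equiv.sigmaAssoc _).symm.trans
    ((Equiv.sigmaCongr e F).trans (Equiv.sigmaAssoc (fun i j => G ⧸ D'.K i j)))
  have hfmk : ∀ (q : Σ i, D.J i) (a : G), f ⟨q.1, q.2, (a : G ⧸ D.K q.1 q.2)⟩ =
      ⟨(e q).1, (e q).2, ((μ a * g q : G) : G ⧸ D'.K (e q).1 (e q).2)⟩ := fun q a => rfl
  refine isomorphic_of_equivariant μ f ?_ ?_
  · rintro a ⟨i, j, b⟩
    induction b using QuotientGroup.induction_on with
    | H b =>
      change f ⟨i, j, ((a * b : G) : G ⧸ D.K i j)⟩ = _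
      rw [hfmk ⟨i, j⟩, hfmk ⟨i, j⟩, map_mul, mul_assoc]
      rfl
  · rintro ⟨i, j, b⟩
    induction b using QuotientGroup.induction_on with
    | H b =>
      rw [hfmk ⟨i, j⟩, value_mk, value_mk, lam_mul, map_lam μ hμ]
      exact congrArg _ (hg ⟨i, j⟩)

end Datum

end YangBaxter

/-! ### Subgroups of finite cyclic groups. -/

section CyclicGroup

variable {G : Type*} [Group G]

/-- A subgroup of order `m` lies in the kernel of the `m`-th power map, which in a cyclic group has
`gcd(|G|, m) ≤ m` elements. It is therefore that kernel. -/
theorem IsCyclic.subgroup_eq_of_card_eq [Finite G] [IsCyclic G] {H K : Subgroup G}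
    (h : Nat.card H = Nat.card K) : H = K := by
  let _ : CommGroup G := IsCyclic.commGroup
  have key : ∀ L : Subgroup G, L = (powMonoidHom (Nat.card L) : G →* G).ker := by
    intro L
    refine Subgroup.eq_of_le_of_card_ge (fun x hx => ?_) ?_
    · have h1 : (⟨x, hx⟩ : L) ^ Nat.card L = 1 := pow_card_eq_one'
      exact congrArg Subtype.val h1
    · rw [IsCyclic.card_powMonoidHom_ker]
      exact Nat.gcd_le_right _ Nat.card_pos
  rw [key H, key K, h]

/-- In a nontrivial cyclic `p`-group the nontrivial subgroups have a common nontrivial element. -/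
theorem IsCyclic.exists_mem_of_ne_bot [IsCyclic G] {p n : ℕ} (hp : p.Prime)
    (hG : Nat.card G = p ^ n) (hn : n ≠ 0) : ∃ z : G, z ≠ 1 ∧ ∀ K : Subgroup G, K ≠ ⊥ → z ∈ K := by
  have : Fact p.Prime := ⟨hp⟩
  have : Finite G := Nat.finite_of_card_ne_zero (by rw [hG]; exact pow_ne_zero _ hp.ne_zero)
  -- By Cauchy every nontrivial subgroup contains the unique subgroup of order `p`.
  have key : ∀ K : Subgroup G, K ≠ ⊥ → ∃ z ∈ K, orderOf z = p := by
    intro K hK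
    have h1 : Nat.card K ∣ p ^ n := hG ▸ K.card_subgroup_dvd_card
    obtain ⟨k, -, hk⟩ := (Nat.dvd_prime_pow hp).mp h1
    have hk0 : k ≠ 0 := by
      rintro rfl
      exact hK (K.eq_bot_of_card_eq (by simpa using hk))
    obtain ⟨z, hz⟩ := exists_prime_orderOf_dvd_card' (G := K) p (hk ▸ dvd_pow_self p hk0)
    exact ⟨z, z.2, by rw [Subgroup.orderOf_coe, hz]⟩
  have htop : (⊤ : Subgroup G) ≠ ⊥ := by
    intro h
    have h1 : Nat.card (⊤ : Subgroup G) = p ^ n := by rw [Subgroup.card_top, hG]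
    rw [h, Subgroup.card_bot] at h1
    exact (Nat.one_lt_pow hn hp.one_lt).ne h1
  obtain ⟨z, -, hz⟩ := key ⊤ htop
  refine ⟨z, ?_, fun K hK => ?_⟩
  · rintro rfl
    exact hp.one_lt.ne (by rw [← hz, orderOf_one])
  · obtain ⟨y, hy, hyp⟩ := key K hK
    have h : Subgroup.zpowers z = Subgroup.zpowers y :=
      IsCyclic.subgroup_eq_of_card_eq (by rw [Nat.card_zpowers, Nat.card_zpowers, hz, hyp])
    exact Subgroup.zpowers_le.mpr hy (h ▸ Subgroup.mem_zpowers z)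

end CyclicGroup

/-! ### Divisibility by powers of `p` in `ℤ/(p^n)`. -/

namespace CyclicBrace

open LeftBrace

variable {p n i : ℕ}

theorem natCast_pow_eq_zero {k : ℕ} (hk : n ≤ k) : (p : ZMod (p ^ n)) ^ k = 0 := by
  rw [← Nat.cast_pow, ZMod.natCast_eq_zero_iff]
  exact pow_dvd_pow p hk

section ZMod

variable [hp : Fact p.Prime]

theorem exists_natCast_eq (x : ZMod (p ^ n)) : ∃ m : ℕ, x = m :=
  ⟨x.val, (ZMod.natCast_zmod_val x).symm⟩

/-- For `j ≤ n`, divisibility by `p^j` is unaffected by adding multiples of `p^n`. -/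
theorem pow_dvd_natCast_iff {j : ℕ} (hj : j ≤ n) (m : ℕ) :
    (p : ZMod (p ^ n)) ^ j ∣ (m : ZMod (p ^ n)) ↔ p ^ j ∣ m := by
  constructor
  · rintro ⟨y, hy⟩
    obtain ⟨y, rfl⟩ := exists_natCast_eq y
    rw [← Nat.cast_pow, ← Nat.cast_mul, ZMod.natCast_eq_natCast_iff] at hy
    exact (hy.dvd_iff (pow_dvd_pow p hj)).mpr (dvd_mul_right _ _)
  · rintro ⟨y, rfl⟩
    exact ⟨y, by push_cast; ring⟩

theorem isUnit_natCast_iff (hn : 0 < n) (m : ℕ) : IsUnit (m : ZMod (p ^ n)) ↔ ¬ p ∣ m := by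
  rw [ZMod.isUnit_iff_coprime, Nat.coprime_pow_right_iff hn, Nat.coprime_comm,
    hp.out.coprime_iff_not_dvd]

theorem isUnit_iff_not_dvd (hn : 0 < n) (x : ZMod (p ^ n)) :
    IsUnit x ↔ ¬ (p : ZMod (p ^ n)) ∣ x := by
  obtain ⟨m, rfl⟩ := exists_natCast_eq x
  have h := pow_dvd_natCast_iff (p := p) (Nat.succ_le_of_lt hn) m
  rw [Nat.succ_eq_add_one, zero_add, pow_one, pow_one] at h
  rw [isUnit_natCast_iff hn, h]

theorem exists_eq_mul_pow (x : ZMod (p ^ n)) :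
    ∃ k ≤ n, ∃ u : ℕ, ¬ p ∣ u ∧ x = u * (p : ZMod (p ^ n)) ^ k := by
  obtain ⟨m, rfl⟩ := exists_natCast_eq x
  by_cases hm : p ^ n ∣ m
  -- Zero is written as `1 * p^n`, so that its cofactor is still prime to `p`.
  · refine ⟨n, le_rfl, 1, hp.out.one_lt.ne' ∘ Nat.dvd_one.mp, ?_⟩
    rw [natCast_pow_eq_zero le_rfl, mul_zero, ZMod.natCast_eq_zero_iff]
    exact hm
  · have hm0 : m ≠ 0 := by rintro rfl; exact hm (dvd_zero _)
    obtain ⟨k, u, hu, rfl⟩ := Nat.exists_eq_pow_mul_and_not_dvd hm0 p hp.out.ne_one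
    refine ⟨k, ?_, u, hu, by push_cast; ring⟩
    by_contra hk
    exact hm ((pow_dvd_pow p (not_le.mp hk).le).mul_right u)

/-- This annihilator governs the socle, the orders of stabilizers and the condition on
automorphisms. -/
theorem pow_mul_eq_zero_iff {k : ℕ} (hk : k ≤ n) (x : ZMod (p ^ n)) :
    (p : ZMod (p ^ n)) ^ k * x = 0 ↔ (p : ZMod (p ^ n)) ^ (n - k) ∣ x := by
  obtain ⟨m, rfl⟩ := exists_natCast_eq x
  rw [pow_dvd_natCast_iff (Nat.sub_le n k), ← Nat.cast_pow, ← Nat.cast_mul,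
    ZMod.natCast_eq_zero_iff]
  conv_lhs => rw [← Nat.add_sub_cancel' hk, pow_add]
  exact Nat.mul_dvd_mul_iff_left (pow_pos hp.out.pos k)

theorem mem_zmultiples_iff_dvd (c x : ZMod (p ^ n)) : x ∈ AddSubgroup.zmultiples c ↔ c ∣ x := by
  rw [AddSubgroup.mem_zmultiples_iff]
  constructor
  · rintro ⟨k, rfl⟩
    exact ⟨k, by rw [zsmul_eq_mul, mul_comm]⟩
  · rintro ⟨y, rfl⟩
    exact ⟨y.val, by simp [mul_comm]⟩

theorem card_zmultiples_pow {j : ℕ} (hj : j ≤ n) :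
    Nat.card (AddSubgroup.zmultiples ((p : ZMod (p ^ n)) ^ j)) = p ^ (n - j) := by
  rw [Nat.card_zmultiples, ← Nat.cast_pow, ZMod.addOrderOf_coe _ (pow_ne_zero _ hp.out.ne_zero),
    Nat.gcd_eq_right (pow_dvd_pow p hj), Nat.pow_div hj hp.out.pos]

theorem ncard_coset {j : ℕ} (hj : j ≤ n) (c : ZMod (p ^ n)) :
    {a : CyclicBrace p n i | ∃ x : ZMod (p ^ n), toZMod a = c + (p : ZMod (p ^ n)) ^ j * x}.ncard =
      p ^ (n - j) := by
  rw [← card_zmultiples_pow hj, ← Nat.card_coe_set_eq]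
  refine Nat.card_congr (toZMod.trans (Equiv.subRight c) |>.subtypeEquiv fun a => ?_)
  change _ ↔ toZMod a - c ∈ _
  rw [mem_zmultiples_iff_dvd]
  exact exists_congr fun x => sub_eq_iff_eq_add'.symm

end ZMod

end CyclicBrace

/-! ### The brace `G_i`: action, socle, cyclicity. -/

namespace CyclicBrace

open LeftBrace

variable {p n i : ℕ}

/-- The additive automorphisms are the multiplications by units. -/
theorem exists_unit_of_map_add (f : CyclicBrace p n i ≃ CyclicBrace p n i)
    (hf : ∀ a b, f (a + b) = f a + f b) :
    ∃ u : (ZMod (p ^ n))ˣ, ∀ x, toZMod (f x) = u * toZMod x := by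
  let g : AddAut (ZMod (p ^ n)) := AddEquiv.mk f hf
  refine ⟨(ZMod.AddAutEquivUnits (p ^ n) g).toMul, fun x => ?_⟩
  have h := DFunLike.congr_fun ((ZMod.AddAutEquivUnits (p ^ n)).symm_apply_apply g) (toZMod x)
  exact h.symm

theorem card_eq : Nat.card (CyclicBrace p n i) = p ^ n := Nat.card_zmod _

section Brace

variable [NeZero i]

theorem toZMod_one : toZMod (1 : CyclicBrace p n i) = 0 := rfl

theorem mul_comm' (a b : CyclicBrace p n i) : a * b = b * a := by
  apply toZMod.injective
  rw [toZMod_mul, toZMod_mul]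
  ring

theorem toZMod_lam (x a : CyclicBrace p n i) :
    toZMod (lam x a) = (1 + (p : ZMod (p ^ n)) ^ i * toZMod x) * toZMod a := by
  change toZMod x + toZMod a + (p : ZMod (p ^ n)) ^ i * toZMod x * toZMod a - toZMod x = _
  ring

/-- Multiplying by the ring element `1` is `y ↦ 1 + (1 + p^i) y`, so its powers are geometric sums.
The order of this element thereby becomes a question of valuations. -/
theorem toZMod_symm_one_pow (m : ℕ) : toZMod ((toZMod.symm 1 : CyclicBrace p n i) ^ m) =
    ((∑ k ∈ Finset.range m, (1 + p ^ i) ^ k : ℕ) : ZMod (p ^ n)) := by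
  induction m with
  | zero => simp [toZMod_one]
  | succ m ih =>
    rw [pow_succ', toZMod_mul, ih, Equiv.apply_symm_apply]
    have h : ∑ k ∈ Finset.range (m + 1), (1 + p ^ i) ^ k =
        1 + (1 + p ^ i) * ∑ k ∈ Finset.range m, (1 + p ^ i) ^ k := by
      rw [Finset.sum_range_succ', Finset.mul_sum, add_comm]
      simp [pow_succ']
    rw [h]
    push_cast
    ring

/-- The orbits are cosets of ideals of `ℤ/(p^n)`. -/
theorem orbit_eq {a : CyclicBrace p n i} {u : ZMod (p ^ n)} {k : ℕ} (hu : IsUnit u)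
    (ha : toZMod a = u * (p : ZMod (p ^ n)) ^ k) :
    orbit a = {b | ∃ x : ZMod (p ^ n), toZMod b = toZMod a + (p : ZMod (p ^ n)) ^ (i + k) * x} := by
  obtain ⟨u, rfl⟩ := hu
  ext b
  constructor
  · rintro ⟨g, rfl⟩
    refine ⟨toZMod g * u, ?_⟩
    rw [toZMod_lam, ha]
    ring
  · rintro ⟨x, hx⟩
    -- Acting by `g` adds `p^(i+k) g u` to `a`; as `u` is a unit, `g = x u⁻¹` reaches every `x`.
    refine ⟨toZMod.symm (x * (u⁻¹ : (ZMod (p ^ n))ˣ)), toZMod.injective ?_⟩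
    change toZMod (lam _ a) = _
    rw [toZMod_lam, hx, Equiv.apply_symm_apply, ha]
    have h := u.inv_mul
    linear_combination ((p : ZMod (p ^ n)) ^ (i + k) * x) * h

theorem mem_stab_iff {a g : CyclicBrace p n i} :
    g ∈ stab a ↔ (p : ZMod (p ^ n)) ^ i * toZMod a * toZMod g = 0 := by
  change lam g a = a ↔ _
  rw [← toZMod.injective.eq_iff, toZMod_lam, add_mul, one_mul, add_eq_left]
  exact Eq.congr_left (by ring)

theorem mem_stab_iff_of_eq {a g : CyclicBrace p n i} {u : ZMod (p ^ n)} {k : ℕ} (hu : IsUnit u)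
    (ha : toZMod a = u * (p : ZMod (p ^ n)) ^ k) :
    g ∈ stab a ↔ (p : ZMod (p ^ n)) ^ (i + k) * toZMod g = 0 := by
  rw [mem_stab_iff, ha, ← hu.mul_right_eq_zero (b := (p : ZMod (p ^ n)) ^ (i + k) * toZMod g)]
  exact Eq.congr_left (by ring)

theorem mem_socle_iff {g : CyclicBrace p n i} :
    g ∈ socle (CyclicBrace p n i) ↔ (p : ZMod (p ^ n)) ^ i * toZMod g = 0 := by
  constructor
  · intro h
    -- Since `lam g` is a ring multiplication, it is trivial as soon as it fixes `1`.
    have h1 : lam g (toZMod.symm 1) = toZMod.symm 1 :=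
      DFunLike.congr_fun (congrArg Multiplicative.toAdd (MonoidHom.mem_ker.mp h)) _
    have h2 : g ∈ stab (toZMod.symm 1 : CyclicBrace p n i) := h1
    simpa using (mem_stab_iff_of_eq (k := 0) isUnit_one (by simp)).mp h2
  · intro h
    refine MonoidHom.mem_ker.mpr (congrArg Multiplicative.ofAdd (AddEquiv.ext fun a => ?_))
    apply toZMod.injective
    rw [toZMod_lam, h, add_zero, one_mul]
    rfl

theorem mul_eq_add_of_mem_socle {x : CyclicBrace p n i} (hx : x ∈ socle (CyclicBrace p n i))
    (y : CyclicBrace p n i) : x * y = x + y := by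
  apply toZMod.injective
  rw [toZMod_mul, mem_socle_iff.mp hx, zero_mul, add_zero, toZMod_add]

/-- The two sides differ by `p^i u (u - 1) a b`. Taking `a = b = 1` and cancelling `u` leaves `p^i
(u - 1) = 0`. -/
theorem unit_mul_map_mul_iff (hin : i ≤ n) [Fact p.Prime]
    (f : CyclicBrace p n i ≃ CyclicBrace p n i) (u : (ZMod (p ^ n))ˣ)
    (hf : ∀ x, toZMod (f x) = u * toZMod x) : (∀ a b, f (a * b) = f a * f b) ↔
      ∃ k : ZMod (p ^ n), (u : ZMod (p ^ n)) = 1 + (p : ZMod (p ^ n)) ^ (n - i) * k := by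
  have h1 : (∀ a b, f (a * b) = f a * f b) ↔ (p : ZMod (p ^ n)) ^ i * (u - 1) = 0 := by
    constructor
    · intro h
      have h2 := congrArg toZMod (h (toZMod.symm 1) (toZMod.symm 1))
      rw [hf, toZMod_mul, toZMod_mul, hf, Equiv.apply_symm_apply] at h2
      have h3 := u.mul_inv
      linear_combination (-(u⁻¹ : (ZMod (p ^ n))ˣ) : ZMod (p ^ n)) * h2 +
        (-(p : ZMod (p ^ n)) ^ i * (u - 1)) * h3
    · intro h a b
      apply toZMod.injective
      rw [hf, toZMod_mul, toZMod_mul, hf, hf]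
      linear_combination (-u * toZMod a * toZMod b) * h
  rw [h1, pow_mul_eq_zero_iff hin]
  exact exists_congr fun k => sub_eq_iff_eq_add'

end Brace

section Prime

variable [hp : Fact p.Prime]

instance : Finite (CyclicBrace p n i) :=
  have : NeZero (p ^ n) := ⟨pow_ne_zero _ hp.out.ne_zero⟩
  inferInstanceAs (Finite (ZMod (p ^ n)))

variable [NeZero i]

/-- Times `p^i`, the sum is `(1 + p^i)^(p^(n-1)) - 1`, of valuation exactly `i + (n - 1)` by lifting
the exponent. The sum itself has valuation `n - 1`. -/
theorem not_pow_dvd_sum (hn : 0 < n) (h2 : p = 2 → 2 ≤ i) :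
    ¬ p ^ n ∣ ∑ k ∈ Finset.range (p ^ (n - 1)), (1 + p ^ i) ^ k := by
  intro h
  have hi : i ≠ 0 := NeZero.ne i
  have h3 : (p : ℤ) ^ (n + i) ∣ (1 + (p : ℤ) ^ i) ^ (p ^ (n - 1)) - 1 ^ (p ^ (n - 1)) := by
    rw [one_pow, ← mul_geom_sum, add_sub_cancel_left, add_comm n i, pow_add]
    apply mul_dvd_mul_left
    exact_mod_cast h
  have hx : ¬ (p : ℤ) ∣ 1 + (p : ℤ) ^ i := by
    rw [Int.dvd_add_left (dvd_pow_self _ hi)]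
    exact_mod_cast hp.out.one_lt.ne' ∘ Nat.dvd_one.mp
  have key : emultiplicity (p : ℤ) ((1 + (p : ℤ) ^ i) ^ (p ^ (n - 1)) - 1 ^ (p ^ (n - 1))) =
      i + (n - 1 : ℕ) := by
    have h5 : emultiplicity (p : ℤ) (1 + (p : ℤ) ^ i - 1) = i := by
      rw [add_sub_cancel_left]
      exact emultiplicity_pow_self_of_prime (Nat.prime_iff_prime_int.mp hp.out) i
    have h6 : emultiplicity p (p ^ (n - 1)) = (n - 1 : ℕ) :=
      emultiplicity_pow_self_of_prime hp.out.prime _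
    by_cases hp2 : p = 2
    · subst hp2
      -- Lifting the exponent at `2` in this form needs `4 ∣ x - y = 2^i`, whence the assumption `i
      -- ≥ 2`.
      have h4 := Int.two_pow_sub_pow' (x := 1 + (2 : ℤ) ^ i) (y := 1) (2 ^ (n - 1)) (by
        rw [add_sub_cancel_left]
        exact pow_dvd_pow 2 (h2 rfl)) (by exact_mod_cast hx)
      have h7 : emultiplicity (2 : ℤ) ((2 ^ (n - 1) : ℕ) : ℤ) = (n - 1 : ℕ) := by
        rw [← h6]
        exact Int.natCast_emultiplicity 2 _
      push_cast at h4 h5 h7 ⊢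
      rw [h4, h5, h7]
    · rw [Int.emultiplicity_pow_sub_pow hp.out (hp.out.odd_of_ne_two hp2) _ hx, h5, h6]
      rw [add_sub_cancel_left]
      exact dvd_pow_self _ hi
  have h8 := le_emultiplicity_of_pow_dvd h3
  rw [key] at h8
  have h9 : n + i ≤ i + (n - 1) := by exact_mod_cast h8
  omega

theorem isCyclic (hn : 0 < n) (h2 : p = 2 → 2 ≤ i) : IsCyclic (CyclicBrace p n i) := by
  apply isCyclic_of_orderOf_eq_card (toZMod.symm 1 : CyclicBrace p n i)
  rw [card_eq]
  obtain ⟨m, rfl⟩ : ∃ m, n = m + 1 := ⟨n - 1, by omega⟩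
  apply orderOf_eq_prime_pow
  · intro h
    have h1 := congrArg toZMod h
    rw [toZMod_symm_one_pow, toZMod_one, ZMod.natCast_eq_zero_iff] at h1
    exact not_pow_dvd_sum hn h2 h1
  · have h := pow_card_eq_one' (x := (toZMod.symm 1 : CyclicBrace p (m + 1) i))
    rwa [card_eq] at h

theorem card_subgroup_of_mem_iff {j : ℕ} (hj : j ≤ n) {H : Subgroup (CyclicBrace p n i)}
    (h : ∀ g, g ∈ H ↔ (p : ZMod (p ^ n)) ^ j * toZMod g = 0) : Nat.card H = p ^ j := by
  have h1 := card_zmultiples_pow (p := p) (Nat.sub_le n j)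
  rw [Nat.sub_sub_self hj] at h1
  rw [← h1]
  refine Nat.card_congr (toZMod.subtypeEquiv fun a => ?_)
  rw [h, mem_zmultiples_iff_dvd, pow_mul_eq_zero_iff hj]

theorem card_stab {a : CyclicBrace p n i} {u : ZMod (p ^ n)} {k : ℕ} (hk : i + k ≤ n)
    (hu : IsUnit u) (ha : toZMod a = u * (p : ZMod (p ^ n)) ^ k) :
    Nat.card (stab a) = p ^ (i + k) :=
  card_subgroup_of_mem_iff hk fun _ => mem_stab_iff_of_eq hu ha

theorem mem_socle_iff_dvd (hin : i ≤ n) {g : CyclicBrace p n i} :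
    g ∈ socle (CyclicBrace p n i) ↔ (p : ZMod (p ^ n)) ^ (n - i) ∣ toZMod g := by
  rw [mem_socle_iff, pow_mul_eq_zero_iff hin]

theorem coe_socle_eq_zmultiples (hin : i ≤ n) :
    (socle (CyclicBrace p n i) : Set (CyclicBrace p n i)) =
      AddSubgroup.zmultiples (socGen p n i) := by
  ext g
  exact (mem_socle_iff_dvd hin).trans (mem_zmultiples_iff_dvd _ _).symm

theorem card_socle (hin : i ≤ n) : Nat.card (socle (CyclicBrace p n i)) = p ^ i :=
  card_subgroup_of_mem_iff hin fun _ => mem_socle_iff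

theorem socGen_pow (hin : i ≤ n) (m : ℕ) : socGen p n i ^ m = m • socGen p n i := by
  have h : socGen p n i ∈ socle (CyclicBrace p n i) := (mem_socle_iff_dvd hin).mpr dvd_rfl
  induction m with
  | zero => rw [pow_zero, zero_smul, one_eq_zero]
  | succ m ih => rw [pow_succ', mul_eq_add_of_mem_socle h, ih, succ_nsmul']

theorem socle_eq_socSubgroup (hin : i ≤ n) : socle (CyclicBrace p n i) = socSubgroup p n i := by
  apply SetLike.coe_injective
  rw [coe_socle_eq_zmultiples hin]
  ext g
  rw [socSubgroup, SetLike.mem_coe, SetLike.mem_coe, ← mem_multiples_iff_mem_zmultiples,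
    ← mem_powers_iff_mem_zpowers]
  exact exists_congr fun m => by simp only [socGen_pow hin]

/-- Product and sum coincide on the socle, so an additive isomorphism serves both operations. -/
theorem exists_socle_equiv (hin : i ≤ n) :
    ∃ e : socle (CyclicBrace p n i) ≃ ZMod (p ^ i),
      (∀ x y, e (x * y) = e x + e y) ∧
        ∀ x y z : socle (CyclicBrace p n i),
          (z : CyclicBrace p n i) = x + y → e z = e x + e y := by
  let A := AddSubgroup.zmultiples (socGen p n i)
  have hset := coe_socle_eq_zmultiples (p := p) hin
  let s : socle (CyclicBrace p n i) ≃ A := Equiv.setCongr hset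
  have hcard : Nat.card A = p ^ i := by rw [← Nat.card_congr s, card_socle hin]
  have hA : IsAddCyclic A := inferInstance
  let e₁ : A ≃+ ZMod (Nat.card A) := (zmodAddCyclicAddEquiv hA).symm
  let e₂ : ZMod (Nat.card A) ≃+ ZMod (p ^ i) := (ZMod.ringEquivCongr hcard).toAddEquiv
  have hadd : ∀ x y z : socle (CyclicBrace p n i),
      (z : CyclicBrace p n i) = x + y → e₂ (e₁ (s z)) = e₂ (e₁ (s x)) + e₂ (e₁ (s y)) := by
    intro x y z h
    have h1 : s z = s x + s y := Subtype.ext h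
    rw [h1, map_add, map_add]
  refine ⟨s.trans (e₁.trans e₂).toEquiv, fun x y => hadd _ _ _ ?_, hadd⟩
  exact mul_eq_add_of_mem_socle x.2 y

end Prime

end CyclicBrace

/-! ### Brace automorphisms. -/

namespace CyclicBrace

open LeftBrace

variable {p n i : ℕ} [hp : Fact p.Prime] [NeZero i]

/-- The brace automorphisms are the multiplications by the units `1 + p^(n-i) k`. -/
theorem exists_braceAut_hom (hin : i ≤ n) :
    ∃ F : braceAut (CyclicBrace p n i) →* (ZMod (p ^ n))ˣ,
      Function.Injective F ∧
      (∀ f x, toZMod (f.1 x) = (F f : ZMod (p ^ n)) * toZMod x) ∧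
      (i < n → (Set.range fun f => (F f : ZMod (p ^ n))) =
        {a | ∃ k : ZMod (p ^ n), a = 1 + (p : ZMod (p ^ n)) ^ (n - i) * k}) ∧
      (i = n → Function.Surjective F) := by
  choose F hF using fun f : braceAut (CyclicBrace p n i) =>
    exists_unit_of_map_add f.1.toEquiv f.2
  have hF' : ∀ f x, toZMod (f.1 x) = (F f : ZMod (p ^ n)) * toZMod x := hF
  have hF1 : ∀ f, (F f : ZMod (p ^ n)) = toZMod (f.1 (toZMod.symm 1)) := fun f => by
    rw [hF', Equiv.apply_symm_apply, mul_one]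
  have hmem : ∀ u : (ZMod (p ^ n))ˣ,
      (∃ k : ZMod (p ^ n), (u : ZMod (p ^ n)) = 1 + (p : ZMod (p ^ n)) ^ (n - i) * k) →
        ∃ f, F f = u := by
    intro u hu
    let f : CyclicBrace p n i ≃ CyclicBrace p n i :=
      toZMod.trans (u.mulLeft.trans toZMod.symm)
    have hf : ∀ x, toZMod (f x) = u * toZMod x := fun x => rfl
    let f' : MulAut (CyclicBrace p n i) :=
      MulEquiv.mk f ((unit_mul_map_mul_iff hin f u hf).mpr hu)
    have hf' : f' ∈ braceAut (CyclicBrace p n i) := fun x y => by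
      apply toZMod.injective
      change (u : ZMod (p ^ n)) * (toZMod x + toZMod y) = u * toZMod x + u * toZMod y
      rw [mul_add]
    refine ⟨⟨f', hf'⟩, Units.ext ?_⟩
    rw [hF1]
    exact mul_one _
  refine ⟨⟨⟨F, ?_⟩, ?_⟩, ?_, hF', ?_, ?_⟩
  · apply Units.ext
    rw [hF1]
    exact toZMod.apply_symm_apply _
  · intro f g
    apply Units.ext
    rw [hF1]
    change toZMod (f.1 (g.1 _)) = _
    rw [hF', ← hF1]
    rfl
  · intro f g hfg
    refine Subtype.ext (MulEquiv.ext fun x => toZMod.injective ?_)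
    rw [hF', hF']
    exact congrArg (fun u : (ZMod (p ^ n))ˣ => (u : ZMod (p ^ n)) * toZMod x) hfg
  · intro hlt
    ext a
    constructor
    · rintro ⟨f, rfl⟩
      exact (unit_mul_map_mul_iff hin f.1.toEquiv (F f) (hF' f)).mp f.1.map_mul
    · rintro ⟨k, rfl⟩
      have hu : IsUnit (1 + (p : ZMod (p ^ n)) ^ (n - i) * k) := by
        -- For `i < n` these elements are automatically units: `isUnit_aux` applies with exponent `n
        -- - i` in place of `i`.
        have : NeZero (n - i) := ⟨by omega⟩
        exact isUnit_aux k
      obtain ⟨f, hf⟩ := hmem hu.unit ⟨k, rfl⟩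
      exact ⟨f, congrArg Units.val hf⟩
  · rintro rfl u
    exact hmem u ⟨u - 1, by rw [Nat.sub_self, pow_zero, one_mul, add_sub_cancel]⟩

omit hp in
theorem mul_eq_add_of_eq (hin : i = n) (x y : CyclicBrace p n i) : x * y = x + y := by
  apply toZMod.injective
  rw [toZMod_mul, natCast_pow_eq_zero hin.ge, zero_mul, zero_mul, add_zero, toZMod_add]

omit hp in
theorem map_mul_of_eq (hin : i = n) (f : AddAut (CyclicBrace p n i)) (x y : CyclicBrace p n i) :
    f (x * y) = f x * f y := by
  rw [mul_eq_add_of_eq hin, mul_eq_add_of_eq hin, map_add]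

omit hp [NeZero i] in
theorem nonempty_addAut_mulEquiv :
    Nonempty (Multiplicative (AddAut (CyclicBrace p n i)) ≃* (ZMod (p ^ n))ˣ) :=
  ⟨AddEquiv.toMultiplicativeLeft (ZMod.AddAutEquivUnits (p ^ n))⟩

/-! ### Orbits and stabilizers -/

theorem isUnit_of_mem_X1 (hn : 0 < n) {α : ℕ} (hα : IsParam1 p i α) {a : CyclicBrace p n i}
    (ha : a ∈ X1 p n i α) : IsUnit (toZMod a) := by
  obtain ⟨x, hx⟩ := ha
  rw [hx, isUnit_iff_not_dvd hn, dvd_add_left ((dvd_pow_self _ (NeZero.ne i)).mul_right x),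
    ← isUnit_iff_not_dvd hn, isUnit_natCast_iff hn]
  exact hα.2.2

theorem exists_unit_of_mem_X2 (hn : 0 < n) {β k : ℕ} (hβ : IsParam2 p n i β k)
    {a : CyclicBrace p n i} (ha : a ∈ X2 p n i β k) :
    ∃ u : ZMod (p ^ n), IsUnit u ∧ toZMod a = u * (p : ZMod (p ^ n)) ^ k := by
  obtain ⟨x, hx⟩ := ha
  refine ⟨β + (p : ZMod (p ^ n)) ^ i * x, ?_, by rw [hx]; ring⟩
  rw [isUnit_iff_not_dvd hn, dvd_add_left ((dvd_pow_self _ (NeZero.ne i)).mul_right x),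
    ← isUnit_iff_not_dvd hn, isUnit_natCast_iff hn]
  exact hβ.1.2.2

omit hp [NeZero i] in
theorem mul_eq_zero_of_mem_X3 (hin : i ≤ n) {γ : ℕ} {a : CyclicBrace p n i}
    (ha : a ∈ X3 p n i γ) : (p : ZMod (p ^ n)) ^ i * toZMod a = 0 := by
  rw [Set.mem_singleton_iff.mp ha, Equiv.apply_symm_apply, ← mul_assoc, ← pow_add,
    natCast_pow_eq_zero (by omega), zero_mul]

theorem orbit_eq_X1 (hn : 0 < n) {α : ℕ} (hα : IsParam1 p i α) :
    orbit (toZMod.symm α : CyclicBrace p n i) = X1 p n i α :=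
  orbit_eq (k := 0) ((isUnit_natCast_iff hn α).mpr hα.2.2) (by simp)

theorem orbit_eq_X2 (hn : 0 < n) {β k : ℕ} (hβ : IsParam2 p n i β k) :
    orbit (toZMod.symm (β * (p : ZMod (p ^ n)) ^ k) : CyclicBrace p n i) = X2 p n i β k :=
  orbit_eq ((isUnit_natCast_iff hn β).mpr hβ.1.2.2) rfl

omit hp in
theorem orbit_eq_singleton {a : CyclicBrace p n i} (ha : (p : ZMod (p ^ n)) ^ i * toZMod a = 0) :
    orbit a = {a} := by
  have h : ∀ g, lam g a = a := fun g => by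
    apply toZMod.injective
    rw [toZMod_lam]
    linear_combination (toZMod g) * ha
  ext b
  constructor
  · rintro ⟨g, rfl⟩
    exact h g
  · rintro rfl
    exact ⟨1, h 1⟩

omit hp in
theorem orbit_eq_X3 (hin : i ≤ n) (γ : ℕ) :
    orbit (toZMod.symm ((p : ZMod (p ^ n)) ^ (n - i) * γ) : CyclicBrace p n i) = X3 p n i γ :=
  orbit_eq_singleton (mul_eq_zero_of_mem_X3 hin rfl)

/-- Each orbit is of one of the three kinds. -/
theorem orbit_cases (hn : 0 < n) (hin : i ≤ n) (a : CyclicBrace p n i) :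
    (∃ α, IsParam1 p i α ∧ orbit a = X1 p n i α) ∨
      ¬ IsUnit (toZMod a) ∧
        ((∃ β k, IsParam2 p n i β k ∧ orbit a = X2 p n i β k) ∨
          (∃ γ, IsParam3 p i γ ∧ (i = n → p ∣ γ) ∧ orbit a = X3 p n i γ)) := by
  -- With `a = u p^k`, the three kinds are `k = 0`, `0 < k < n - i`, and the remaining `k ≥ n - i`,
  -- where `p^i a = 0`. Replacing `u` by `u % p^i` stays in the same orbit.
  obtain ⟨k, hk, u, hu, ha⟩ := exists_eq_mul_pow (toZMod a)
  have hu' := (isUnit_natCast_iff (p := p) hn u).mpr hu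
  have hmod : ∀ u : ℕ, (u : ZMod (p ^ n)) =
      (u % p ^ i : ℕ) + (p : ZMod (p ^ n)) ^ i * (u / p ^ i : ℕ) := fun u => by
    conv_lhs => rw [← Nat.mod_add_div u (p ^ i)]
    push_cast
    ring
  have hpar : 1 ≤ u % p ^ i ∧ u % p ^ i ≤ p ^ i ∧ ¬ p ∣ u % p ^ i := by
    have h1 : ¬ p ∣ u % p ^ i := by
      rwa [Nat.dvd_mod_iff (dvd_pow_self p (NeZero.ne i))]
    refine ⟨Nat.one_le_iff_ne_zero.mpr fun h => h1 (h ▸ dvd_zero p), ?_, h1⟩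
    exact (Nat.mod_lt _ (pow_pos hp.out.pos i)).le
  have hcos : ∀ (c c' : ZMod (p ^ n)) (j : ℕ) (d : ZMod (p ^ n)),
      c = c' + (p : ZMod (p ^ n)) ^ j * d →
      {b : CyclicBrace p n i | ∃ x, toZMod b = c + (p : ZMod (p ^ n)) ^ j * x} =
        {b | ∃ x, toZMod b = c' + (p : ZMod (p ^ n)) ^ j * x} := by
    intro c c' j d h
    ext b
    constructor
    · rintro ⟨x, hx⟩
      exact ⟨d + x, by rw [hx, h]; ring⟩
    · rintro ⟨x, hx⟩
      exact ⟨x - d, by rw [hx, h]; ring⟩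
  rcases Nat.eq_zero_or_pos k with rfl | hk0
  · left
    refine ⟨u % p ^ i, hpar, ?_⟩
    rw [orbit_eq hu' ha]
    refine hcos _ _ _ (u / p ^ i : ℕ) ?_
    rw [ha, pow_zero, mul_one, add_zero]
    exact hmod u
  have hnu : ¬ IsUnit (toZMod a) := by
    rw [isUnit_iff_not_dvd hn, not_not, ha]
    exact (dvd_pow_self _ hk0.ne').mul_left _
  refine Or.inr ⟨hnu, ?_⟩
  rcases lt_or_ge (i + k) n with hik | hik
  · left
    refine ⟨u % p ^ i, k, ⟨hpar, hk0, hik⟩, ?_⟩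
    rw [orbit_eq hu' ha]
    refine hcos _ _ _ (u / p ^ i : ℕ) ?_
    rw [ha, hmod u, pow_add]
    ring
  · right
    have h0 : (p : ZMod (p ^ n)) ^ i * toZMod a = 0 := by
      rw [ha, mul_left_comm, ← pow_add, natCast_pow_eq_zero hik, mul_zero]
    obtain ⟨x, hx⟩ := (pow_mul_eq_zero_iff hin _).mp h0
    obtain ⟨m, rfl⟩ := exists_natCast_eq x
    have hx' : toZMod a = (p : ZMod (p ^ n)) ^ (n - i) * (m % p ^ i : ℕ) := by
      rw [hx, hmod m, mul_add, ← mul_assoc _ (_ ^ i), ← pow_add,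
        natCast_pow_eq_zero (k := n - i + i) (by omega), zero_mul, add_zero]
    refine ⟨m % p ^ i, Nat.mod_lt _ (pow_pos hp.out.pos i), fun h => ?_, ?_⟩
    -- For `i = n` the factor `p^(n-i)` is `1`, so being a nonunit is a condition on `γ` itself.
    · rw [hx', h, Nat.sub_self, pow_zero, one_mul, isUnit_natCast_iff hn, not_not] at hnu
      rwa [h]
    · rw [orbit_eq_singleton h0, X3, Set.singleton_eq_singleton_iff]
      exact toZMod.injective hx'

theorem exists_eq_orbit_iff (hn : 0 < n) (hin : i ≤ n) (S : Set (CyclicBrace p n i)) :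
    (∃ a, S = orbit a) ↔
      (∃ α, IsParam1 p i α ∧ S = X1 p n i α) ∨
      (∃ β k, IsParam2 p n i β k ∧ S = X2 p n i β k) ∨
      (∃ γ, IsParam3 p i γ ∧ S = X3 p n i γ) := by
  constructor
  · rintro ⟨a, rfl⟩
    rcases orbit_cases hn hin a with h | ⟨-, h | ⟨γ, hγ, -, h⟩⟩
    exacts [.inl h, .inr (.inl h), .inr (.inr ⟨γ, hγ, h⟩)]
  · rintro (⟨α, hα, rfl⟩ | ⟨β, k, hβ, rfl⟩ | ⟨γ, -, rfl⟩)
    · exact ⟨_, (orbit_eq_X1 hn hα).symm⟩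
    · exact ⟨_, (orbit_eq_X2 hn hβ).symm⟩
    · exact ⟨_, (orbit_eq_X3 hin γ).symm⟩

theorem card_eq_iff_eq_stab (hn : 0 < n) (h2 : p = 2 → 2 ≤ i) {a : CyclicBrace p n i}
    {u : ZMod (p ^ n)} {k : ℕ} (hk : i + k ≤ n) (hu : IsUnit u)
    (ha : toZMod a = u * (p : ZMod (p ^ n)) ^ k) (H : Subgroup (CyclicBrace p n i)) :
    Nat.card H = p ^ (i + k) ↔ H = stab a := by
  have := isCyclic (p := p) hn h2
  constructor
  · intro h
    exact IsCyclic.subgroup_eq_of_card_eq (by rw [h, card_stab hk hu ha])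
  · rintro rfl
    exact card_stab hk hu ha

theorem X1_ncard_and_stab (hn : 0 < n) (hin : i ≤ n) (h2 : p = 2 → 2 ≤ i) {α : ℕ}
    (hα : IsParam1 p i α) : (X1 p n i α).ncard = p ^ (n - i) ∧
      ∀ a ∈ X1 p n i α, ∀ H : Subgroup (CyclicBrace p n i), Nat.card H = p ^ i ↔ H = stab a :=
  ⟨ncard_coset hin _, fun _ ha H => card_eq_iff_eq_stab (k := 0) hn h2 hin
    (isUnit_of_mem_X1 hn hα ha) (by simp) H⟩

theorem X2_ncard_and_stab (hn : 0 < n) (h2 : p = 2 → 2 ≤ i) {β k : ℕ}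
    (hβ : IsParam2 p n i β k) : (X2 p n i β k).ncard = p ^ (n - i - k) ∧
      ∀ a ∈ X2 p n i β k, ∀ H : Subgroup (CyclicBrace p n i),
        Nat.card H = p ^ (i + k) ↔ H = stab a := by
  have hk : i + k ≤ n := by have := hβ.2.2; omega
  refine ⟨by rw [Nat.sub_sub]; exact ncard_coset hk _, fun a ha H => ?_⟩
  obtain ⟨u, hu, hau⟩ := exists_unit_of_mem_X2 hn hβ ha
  exact card_eq_iff_eq_stab hn h2 hk hu hau H

omit hp in
theorem stab_eq_top_of_mem_X3 (hin : i ≤ n) {γ : ℕ} {a : CyclicBrace p n i}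
    (ha : a ∈ X3 p n i γ) : stab a = ⊤ := by
  rw [eq_top_iff]
  intro g _
  rw [mem_stab_iff, mul_eq_zero_of_mem_X3 hin ha, zero_mul]

end CyclicBrace

namespace CyclicBrace

open LeftBrace YangBaxter

variable {p n i : ℕ} [hp : Fact p.Prime] [NeZero i]

/-! ### Basic data -/

omit hp in
theorem normalCore_eq (K : Subgroup (CyclicBrace p n i)) : K.normalCore = K := by
  have : K.Normal := ⟨fun a ha g => by rwa [mul_comm' g, mul_inv_cancel_right]⟩
  exact K.normalCore_eq_self

/-- Cores are the subgroups themselves, as the product is commutative, and nontrivial subgroups of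
the cyclic p-group all contain one fixed `z ≠ 1`. -/
theorem iInf_eq_bot_iff (hn : 0 < n) (h2 : p = 2 → 2 ≤ i) {ι : Type*}
    (K : ι → Subgroup (CyclicBrace p n i)) (P : ι → Prop) :
    ⨅ (q) (_ : P q), (K q).normalCore = ⊥ ↔ ∃ q, P q ∧ K q = ⊥ := by
  have := isCyclic (p := p) hn h2
  obtain ⟨z, hz1, hz⟩ := IsCyclic.exists_mem_of_ne_bot hp.out (card_eq (p := p) (i := i)) hn.ne'
  simp only [normalCore_eq]
  constructor
  · intro h
    by_contra! hne
    refine hz1 (Subgroup.mem_bot.mp (h ▸ ?_))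
    simp only [Subgroup.mem_iInf]
    exact fun q hq => hz _ (hne q hq)
  · rintro ⟨q, hq, hK⟩
    exact le_bot_iff.mp (hK ▸ iInf₂_le q hq)

theorem inf_ne_bot (hn : 0 < n) (h2 : p = 2 → 2 ≤ i) {K L : Subgroup (CyclicBrace p n i)}
    (hK : K ≠ ⊥) (hL : L ≠ ⊥) : K ⊓ L ≠ ⊥ := by
  have := isCyclic (p := p) hn h2
  obtain ⟨z, hz1, hz⟩ := IsCyclic.exists_mem_of_ne_bot hp.out (card_eq (p := p) (i := i)) hn.ne'
  exact fun h => hz1 (Subgroup.mem_bot.mp (h ▸ ⟨hz K hK, hz L hL⟩))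

omit [NeZero i] in
-- All nonunits lie in the proper subgroup `⟨p⟩`, while a single unit generates everything.
theorem closure_eq_top_iff (hn : 0 < n) (S : Set (CyclicBrace p n i)) :
    AddSubgroup.closure S = ⊤ ↔ ∃ a ∈ S, IsUnit (toZMod a) := by
  constructor
  · intro h
    by_contra! hne
    have h1 : AddSubgroup.closure S ≤ AddSubgroup.zmultiples
        (toZMod.symm (p : ZMod (p ^ n)) : CyclicBrace p n i) := by
      rw [AddSubgroup.closure_le]
      intro a ha
      have h2 := hne a ha
      rw [isUnit_iff_not_dvd hn, not_not] at h2
      exact (mem_zmultiples_iff_dvd (p := p) (n := n) _ (toZMod a)).mpr h2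
    rw [h] at h1
    have h2 : (1 : ZMod (p ^ n)) ∈ AddSubgroup.zmultiples (p : ZMod (p ^ n)) :=
      h1 (AddSubgroup.mem_top (toZMod.symm 1 : CyclicBrace p n i))
    rw [mem_zmultiples_iff_dvd] at h2
    exact (isUnit_iff_not_dvd hn _).mp isUnit_one h2
  · rintro ⟨a, ha, hu⟩
    rw [eq_top_iff]
    intro b _
    have h1 : AddSubgroup.zmultiples a ≤ AddSubgroup.closure S := by
      rw [AddSubgroup.zmultiples_le]
      exact AddSubgroup.subset_closure ha
    exact h1 ((mem_zmultiples_iff_dvd (p := p) (n := n) (toZMod a) (toZMod b)).mpr hu.dvd)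

omit hp in
theorem isUnit_iff_of_mem_orbit {a b : CyclicBrace p n i} (h : b ∈ orbit a) :
    IsUnit (toZMod b) ↔ IsUnit (toZMod a) := by
  obtain ⟨g, rfl⟩ := h
  change IsUnit (toZMod (lam g a)) ↔ _
  rw [toZMod_lam, IsUnit.mul_iff, and_iff_right (isUnit_aux _)]

omit hp in
theorem mem_orbit_self (a : CyclicBrace p n i) : a ∈ orbit a := ⟨1, lam_one a⟩

omit hp in
theorem stab_eq_socle {a : CyclicBrace p n i} (ha : IsUnit (toZMod a)) :
    stab a = socle (CyclicBrace p n i) := by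
  ext g
  rw [mem_stab_iff_of_eq (k := 0) ha (by simp), mem_socle_iff, add_zero]

theorem socle_ne_bot (hin : i ≤ n) : socle (CyclicBrace p n i) ≠ ⊥ := by
  intro h
  have h1 := card_socle (p := p) hin
  rw [h, Subgroup.card_bot] at h1
  exact (Nat.one_lt_pow (NeZero.ne i) hp.out.one_lt).ne h1

/-- A subgroup can be enlarged exactly when it is not the full stabilizer and another trivial
subgroup remains: any strict enlargement is nontrivial, and the full stabilizer is the only
enlargement that has to be tested. -/
theorem isBasic_iff (hn : 0 < n) (h2 : p = 2 → 2 ≤ i)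
    (D : Datum.{0, v} (CyclicBrace p n i)) : D.IsBasic ↔
      (∀ q₀ : Σ i, D.J i, ¬ ((∃ q, q ≠ q₀ ∧ IsUnit (toZMod (D.x q.1))) ∧
        ∃ q, q ≠ q₀ ∧ D.K q.1 q.2 = ⊥)) ∧
      (∀ q₀ : Σ i, D.J i, D.K q₀.1 q₀.2 ≠ stab (D.x q₀.1) →
        ¬ ∃ q, q ≠ q₀ ∧ D.K q.1 q.2 = ⊥) := by
  have hcl : ∀ q₀ : Σ i, D.J i, AddSubgroup.closure
      (⋃ (q : Σ i, D.J i) (_ : q ≠ q₀), orbit (D.x q.1)) = ⊤ ↔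
        ∃ q, q ≠ q₀ ∧ IsUnit (toZMod (D.x q.1)) := by
    intro q₀
    rw [closure_eq_top_iff hn]
    simp only [Set.mem_iUnion]
    constructor
    · rintro ⟨a, ⟨q, hq, ha⟩, hu⟩
      exact ⟨q, hq, (isUnit_iff_of_mem_orbit ha).mp hu⟩
    · rintro ⟨q, hq, hu⟩
      exact ⟨_, ⟨q, hq, mem_orbit_self _⟩, hu⟩
  have hinf : ∀ q₀ : Σ i, D.J i, ⨅ (q : Σ i, D.J i) (_ : q ≠ q₀), (D.K q.1 q.2).normalCore = ⊥ ↔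
      ∃ q, q ≠ q₀ ∧ D.K q.1 q.2 = ⊥ := fun q₀ =>
    iInf_eq_bot_iff hn h2 (fun q : Σ i, D.J i => D.K q.1 q.2) _
  constructor
  · rintro ⟨h3, h4⟩
    refine ⟨fun q₀ h => h3 q₀.1 q₀.2 ⟨(hcl q₀).mpr h.1, (hinf q₀).mpr h.2⟩, fun q₀ hne h => ?_⟩
    refine h4 q₀.1 q₀.2 _ (lt_of_le_of_ne (D.K_le_stab _ _) hne) le_rfl ?_
    exact le_bot_iff.mp (inf_le_right.trans ((hinf q₀).mpr h).le)
  · rintro ⟨h3, h4⟩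
    refine ⟨fun i j h => h3 ⟨i, j⟩ ⟨(hcl _).mp h.1, (hinf _).mp h.2⟩, fun i j K' hlt hle => ?_⟩
    rw [normalCore_eq]
    refine inf_ne_bot hn h2 hlt.ne_bot fun h => ?_
    exact h4 ⟨i, j⟩ (hlt.trans_le hle).ne ((hinf _).mp h)

/-- The datum has one orbit, consisting of units, with the trivial subgroup. -/
def IsUnitSingle (D : Datum.{0, v} (CyclicBrace p n i)) : Prop :=
  ∃ q₀ : Σ i, D.J i, (∀ q, q = q₀) ∧ IsUnit (toZMod (D.x q₀.1)) ∧ D.K q₀.1 q₀.2 = ⊥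

/-- The datum has two orbits, one of nonunits with the trivial subgroup and one of units with the
socle. -/
def IsUnitPair (D : Datum.{0, v} (CyclicBrace p n i)) : Prop :=
  ∃ q₁ q₂ : Σ i, D.J i, (∀ q, q = q₁ ∨ q = q₂) ∧
    ¬ IsUnit (toZMod (D.x q₁.1)) ∧ D.K q₁.1 q₁.2 = ⊥ ∧
    IsUnit (toZMod (D.x q₂.1)) ∧ D.K q₂.1 q₂.2 = socle (CyclicBrace p n i)

theorem exists_isUnit (hn : 0 < n) (D : Datum.{0, v} (CyclicBrace p n i)) :
    ∃ q : Σ i, D.J i, IsUnit (toZMod (D.x q.1)) := by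
  obtain ⟨a, ha, hu⟩ := (closure_eq_top_iff hn _).mp D.generates
  obtain ⟨j, hj⟩ := Set.mem_iUnion.mp ha
  obtain ⟨k⟩ := D.nonempty_J j
  exact ⟨⟨j, k⟩, (isUnit_iff_of_mem_orbit hj).mp hu⟩

theorem exists_eq_bot (hn : 0 < n) (h2 : p = 2 → 2 ≤ i) (D : Datum.{0, v} (CyclicBrace p n i)) :
    ∃ q : Σ i, D.J i, D.K q.1 q.2 = ⊥ := by
  have h := (iInf_eq_bot_iff hn h2 (fun q : Σ i, D.J i => D.K q.1 q.2) fun _ => True).mp (by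
    simpa [iInf_sigma] using D.core_eq_bot)
  simpa using h

/-- If a unit orbit carries the trivial subgroup, it suffices alone and all else is removable.
Otherwise a unit orbit `q₂` and a trivial subgroup at `q₁ ≠ q₂` suffice together, and
non-enlargeability makes the subgroup at `q₂` the stabilizer of a unit, the socle. Conversely,
nontriviality of the socle makes both members of such a pair indispensable. -/
theorem isBasic_iff_isUnit (hn : 0 < n) (hin : i ≤ n) (h2 : p = 2 → 2 ≤ i)
    (D : Datum.{0, v} (CyclicBrace p n i)) : D.IsBasic ↔ IsUnitSingle D ∨ IsUnitPair D := by
  rw [isBasic_iff hn h2]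
  constructor
  · rintro ⟨h3, h4⟩
    by_cases hs : ∃ q : Σ i, D.J i, IsUnit (toZMod (D.x q.1)) ∧ D.K q.1 q.2 = ⊥
    · obtain ⟨q₀, hu, hb⟩ := hs
      refine Or.inl ⟨q₀, fun q => ?_, hu, hb⟩
      by_contra hq
      exact h3 q ⟨⟨q₀, Ne.symm hq, hu⟩, ⟨q₀, Ne.symm hq, hb⟩⟩
    · obtain ⟨q₂, hu⟩ := exists_isUnit hn D
      obtain ⟨q₁, hb⟩ := exists_eq_bot hn h2 D
      have hne : q₁ ≠ q₂ := by
        rintro rfl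
        exact hs ⟨_, hu, hb⟩
      refine Or.inr ⟨q₁, q₂, fun q => ?_, fun h => hs ⟨_, h, hb⟩, hb, hu, ?_⟩
      · by_contra! hq
        exact h3 q ⟨⟨q₂, hq.2.symm, hu⟩, ⟨q₁, hq.1.symm, hb⟩⟩
      · by_contra hK
        rw [← stab_eq_socle hu] at hK
        exact h4 q₂ hK ⟨q₁, hne, hb⟩
  · rintro (⟨q₀, hq, hu, hb⟩ | ⟨q₁, q₂, hq, hnu, hb, hu, hs⟩)
    · exact ⟨fun q h => h.1.elim fun q' hq' => hq'.1 ((hq q').trans (hq q).symm),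
        fun q _ h => h.elim fun q' hq' => hq'.1 ((hq q').trans (hq q).symm)⟩
    · have hs' : D.K q₂.1 q₂.2 ≠ ⊥ := hs ▸ socle_ne_bot hin
      constructor
      · rintro q ⟨⟨q', hq', hu'⟩, ⟨q'', hq'', hb''⟩⟩
        rcases hq q with rfl | rfl
        · rcases hq q'' with rfl | rfl
          exacts [hq'' rfl, hs' hb'']
        · rcases hq q' with rfl | rfl
          exacts [hnu hu', hq' rfl]
      · rintro q hne ⟨q', hq', hb'⟩
        rcases hq q with rfl | rfl
        · rcases hq q' with rfl | rfl
          exacts [hq' rfl, hs' hb']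
        · exact hne (by rw [stab_eq_socle hu, hs])

omit [NeZero i] in
theorem not_isUnit_of_mem_X3 (hn : 0 < n) {γ : ℕ} (hγ : i = n → p ∣ γ) (hin : i ≤ n)
    {a : CyclicBrace p n i} (ha : a ∈ X3 p n i γ) : ¬ IsUnit (toZMod a) := by
  rw [isUnit_iff_not_dvd hn, not_not, Set.mem_singleton_iff.mp ha, Equiv.apply_symm_apply]
  rcases hin.lt_or_eq with h | h
  · exact (dvd_pow_self _ (by omega)).mul_right _
  · exact (Nat.cast_dvd_cast (hγ h)).mul_left _

theorem not_isUnit_of_mem_X2 (hn : 0 < n) {β k : ℕ} (hβ : IsParam2 p n i β k)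
    {a : CyclicBrace p n i} (ha : a ∈ X2 p n i β k) : ¬ IsUnit (toZMod a) := by
  obtain ⟨u, -, hu⟩ := exists_unit_of_mem_X2 hn hβ ha
  rw [isUnit_iff_not_dvd hn, not_not, hu]
  exact (dvd_pow_self _ (by have := hβ.2.1; omega)).mul_left _

theorem mul_ne_zero_of_mem_X2 (hn : 0 < n) {β k : ℕ} (hβ : IsParam2 p n i β k)
    {a : CyclicBrace p n i} (ha : a ∈ X2 p n i β k) :
    (p : ZMod (p ^ n)) ^ i * toZMod a ≠ 0 := by
  obtain ⟨u, hu, hau⟩ := exists_unit_of_mem_X2 hn hβ ha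
  rw [hau, mul_left_comm, ← pow_add, Ne, hu.mul_right_eq_zero, ← Nat.cast_pow,
    ZMod.natCast_eq_zero_iff, Nat.pow_dvd_pow_iff_le_right hp.out.one_lt]
  have := hβ.2.2
  omega

theorem isUnitSingle_iff (hn : 0 < n) (hin : i ≤ n) (D : Datum.{0, v} (CyclicBrace p n i)) :
    IsUnitSingle D ↔ IsType1 D := by
  constructor
  · rintro ⟨q, hq, hu, hb⟩
    rcases orbit_cases hn hin (D.x q.1) with ⟨α, hα, h⟩ | h
    · exact ⟨α, hα, q.1, q.2, hq, h, hb⟩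
    · exact absurd hu h.1
  · rintro ⟨α, hα, i, j, hq, h, hb⟩
    exact ⟨⟨i, j⟩, hq, isUnit_of_mem_X1 hn hα (h ▸ mem_orbit_self _), hb⟩

theorem isUnitPair_of_isPair (hn : 0 < n) (hin : i ≤ n) {D : Datum.{0, v} (CyclicBrace p n i)}
    {S : Set (CyclicBrace p n i)} {α : ℕ} (hα : IsParam1 p i α)
    (hS : ∀ a ∈ S, ¬ IsUnit (toZMod a))
    (h : D.IsPair S ⊥ (X1 p n i α) (socSubgroup p n i)) : IsUnitPair D := by
  obtain ⟨i₁, j₁, i₂, j₂, -, hq, h1, hK1, h3, hK2⟩ := h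
  exact ⟨⟨i₁, j₁⟩, ⟨i₂, j₂⟩, hq, hS _ (h1 ▸ mem_orbit_self _), hK1,
    isUnit_of_mem_X1 hn hα (h3 ▸ mem_orbit_self _), hK2.trans (socle_eq_socSubgroup hin).symm⟩

theorem isUnitPair_iff (hn : 0 < n) (hin : i ≤ n) (D : Datum.{0, v} (CyclicBrace p n i)) :
    IsUnitPair D ↔ IsType2 D ∨ IsType3 D := by
  constructor
  · rintro ⟨q₁, q₂, hq, hnu, hb, hu, hs⟩
    have hne : q₁.1 ≠ q₂.1 := fun h => hnu (h ▸ hu)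
    rw [socle_eq_socSubgroup hin] at hs
    rcases orbit_cases hn hin (D.x q₂.1) with ⟨α, hα, h2⟩ | h
    · rcases orbit_cases hn hin (D.x q₁.1) with
        ⟨α, hα, h1⟩ | ⟨-, ⟨β, k, hβ, h1⟩ | ⟨γ, hγ, hγ', h1⟩⟩
      · exact absurd (isUnit_of_mem_X1 hn hα (h1 ▸ mem_orbit_self _)) hnu
      · exact Or.inr ⟨β, k, α, hβ, hα, q₁.1, q₁.2, q₂.1, q₂.2, hne, hq, h1, hb, h2, hs⟩
      · exact Or.inl ⟨γ, α, hγ, hγ', hα, q₁.1, q₁.2, q₂.1, q₂.2, hne, hq, h1, hb, h2, hs⟩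
    · exact absurd hu h.1
  · rintro (⟨γ, α, hγ, hγ', hα, h⟩ | ⟨β, k, α, hβ, hα, h⟩)
    · exact isUnitPair_of_isPair hn hin hα (fun a ha => not_isUnit_of_mem_X3 hn hγ' hin ha) h
    · exact isUnitPair_of_isPair hn hin hα (fun a ha => not_isUnit_of_mem_X2 hn hβ ha) h

theorem isBasic_iff_isType (hn : 0 < n) (hin : i ≤ n) (h2 : p = 2 → 2 ≤ i)
    (D : Datum.{0, v} (CyclicBrace p n i)) :
    D.IsBasic ↔ IsType1 D ∨ IsType2 D ∨ IsType3 D := by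
  rw [isBasic_iff_isUnit hn hin h2, isUnitSingle_iff hn hin, isUnitPair_iff hn hin]

theorem exists_isSingle (hn : 0 < n) {a : CyclicBrace p n i} (ha : IsUnit (toZMod a)) :
    ∃ D : Datum.{0, w} (CyclicBrace p n i), D.IsSingle (orbit a) ⊥ :=
  ⟨{ I := PUnit
     x := fun _ => a
     orbit_injective := fun _ _ _ => rfl
     J := fun _ => PUnit
     nonempty_J := fun _ => ⟨⟨⟩⟩
     K := fun _ _ => ⊥
     K_le_stab := fun _ _ => bot_le
     generates := by
       rw [closure_eq_top_iff hn]
       exact ⟨a, Set.mem_iUnion.mpr ⟨⟨⟩, mem_orbit_self a⟩, ha⟩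
     core_eq_bot := le_bot_iff.mp <| (iInf₂_le ⟨⟩ ⟨⟩).trans (Subgroup.normalCore_le _) },
   ⟨⟩, ⟨⟩, fun _ => rfl, rfl, rfl⟩

theorem exists_isPair (hn : 0 < n) (hin : i ≤ n) {a b : CyclicBrace p n i}
    (ha : ¬ IsUnit (toZMod a)) (hb : IsUnit (toZMod b)) :
    ∃ D : Datum.{0, w} (CyclicBrace p n i),
      D.IsPair (orbit a) ⊥ (orbit b) (socSubgroup p n i) := by
  have hne : orbit a ≠ orbit b := fun h =>
    ha ((isUnit_iff_of_mem_orbit (h ▸ mem_orbit_self a)).mpr hb)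
  exact ⟨
   { I := ULift Bool
     x := fun c => if c.down then b else a
     orbit_injective := by
       rintro ⟨_ | _⟩ ⟨_ | _⟩ h
       exacts [rfl, absurd h hne, absurd h.symm hne, rfl]
     J := fun _ => PUnit
     nonempty_J := fun _ => ⟨⟨⟩⟩
     K := fun c _ => if c.down then socSubgroup p n i else ⊥
     K_le_stab := by
       rintro ⟨_ | _⟩ _
       · exact bot_le
       · change socSubgroup p n i ≤ stab b
         rw [stab_eq_socle hb, socle_eq_socSubgroup hin]
     generates := by
       rw [closure_eq_top_iff hn]
       exact ⟨b, Set.mem_iUnion.mpr ⟨⟨true⟩, mem_orbit_self b⟩, hb⟩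
     core_eq_bot := le_bot_iff.mp <| (iInf₂_le ⟨false⟩ ⟨⟩).trans (Subgroup.normalCore_le _) },
    ⟨false⟩, ⟨⟩, ⟨true⟩, ⟨⟩, by simp, by rintro ⟨⟨_ | _⟩, _⟩ <;> simp, rfl, rfl, rfl, rfl⟩

end CyclicBrace

namespace CyclicBrace

open LeftBrace YangBaxter

variable {p n i : ℕ} [hp : Fact p.Prime] [NeZero i]

/-! ### Isomorphisms between the solutions -/

theorem isUnit_of_mem_X_of_isType1 (hn : 0 < n) {D : Datum.{0, v} (CyclicBrace p n i)}
    (h : IsType1 D) : ∀ a ∈ D.X, IsUnit (toZMod a) := by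
  obtain ⟨α, hα, j, k, hq, h, -⟩ := h
  intro a ha
  obtain ⟨j', hj'⟩ := Set.mem_iUnion.mp ha
  obtain ⟨k'⟩ := D.nonempty_J j'
  obtain rfl : j' = j := congrArg Sigma.fst (hq ⟨j', k'⟩)
  exact isUnit_of_mem_X1 hn hα (h ▸ hj')

omit hp in
theorem X_eq_union_of_isPair {D : Datum.{0, v} (CyclicBrace p n i)} {S T : Set (CyclicBrace p n i)}
    {K L : Subgroup (CyclicBrace p n i)} (h : D.IsPair S K T L) : D.X = S ∪ T := by
  obtain ⟨i₁, j₁, i₂, j₂, -, hq, h1, -, h2, -⟩ := h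
  ext a
  rw [Datum.X, Set.mem_iUnion, ← h1, ← h2]
  constructor
  · rintro ⟨j, hj⟩
    obtain ⟨k⟩ := D.nonempty_J j
    rcases hq ⟨j, k⟩ with h | h <;> obtain rfl := congrArg Sigma.fst h
    exacts [Or.inl hj, Or.inr hj]
  · rintro (h | h)
    exacts [⟨_, h⟩, ⟨_, h⟩]

theorem nonunits_of_isType2 (hn : 0 < n) (hin : i ≤ n) {D : Datum.{0, v} (CyclicBrace p n i)}
    (h : IsType2 D) : ∃ a ∈ D.X, ¬ IsUnit (toZMod a) ∧ (p : ZMod (p ^ n)) ^ i * toZMod a = 0 := by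
  obtain ⟨γ, α, hγ, hγ', hα, h⟩ := h
  rw [X_eq_union_of_isPair h]
  exact ⟨_, Or.inl rfl, not_isUnit_of_mem_X3 hn hγ' hin rfl, mul_eq_zero_of_mem_X3 hin rfl⟩

theorem nonunits_of_isType3 (hn : 0 < n) {D : Datum.{0, v} (CyclicBrace p n i)}
    (h : IsType3 D) : (∃ a ∈ D.X, ¬ IsUnit (toZMod a)) ∧
      ∀ a ∈ D.X, ¬ IsUnit (toZMod a) → (p : ZMod (p ^ n)) ^ i * toZMod a ≠ 0 := by
  obtain ⟨β, k, α, hβ, hα, h⟩ := h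
  rw [X_eq_union_of_isPair h]
  constructor
  · have h1 : (toZMod.symm (β * (p : ZMod (p ^ n)) ^ k) : CyclicBrace p n i) ∈ X2 p n i β k :=
      ⟨0, by rw [mul_zero, add_zero, Equiv.apply_symm_apply]⟩
    exact ⟨_, Or.inl h1, not_isUnit_of_mem_X2 hn hβ h1⟩
  · rintro a (ha | ha) hu
    · exact mul_ne_zero_of_mem_X2 hn hβ ha
    · exact absurd (isUnit_of_mem_X1 hn hα ha) hu

/-- The type of a datum is determined by its invariant subset, up to multiplication by units. -/
theorem isType_of_image_X (hn : 0 < n) (hin : i ≤ n) {D D' : Datum.{0, v} (CyclicBrace p n i)}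
    (hD : IsType1 D ∨ IsType2 D ∨ IsType3 D) (hD' : IsType1 D' ∨ IsType2 D' ∨ IsType3 D')
    {u : ZMod (p ^ n)} (hu : IsUnit u)
    (h : toZMod '' D'.X = (fun a => u * a) '' (toZMod '' D.X)) :
    (IsType1 D ∧ IsType1 D') ∨ (IsType2 D ∧ IsType2 D') ∨ (IsType3 D ∧ IsType3 D') := by
  have h1 : ∀ a ∈ D.X, ∃ b ∈ D'.X, toZMod b = u * toZMod a := by
    intro a ha
    have h2 : u * toZMod a ∈ toZMod '' D'.X := h ▸ ⟨_, ⟨a, ha, rfl⟩, rfl⟩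
    exact h2
  have h2 : ∀ b ∈ D'.X, ∃ a ∈ D.X, toZMod b = u * toZMod a := by
    intro b hb
    have h2 : toZMod b ∈ (fun a => u * a) '' (toZMod '' D.X) := h ▸ ⟨b, hb, rfl⟩
    obtain ⟨_, ⟨a, ha, rfl⟩, hab⟩ := h2
    exact ⟨a, ha, hab.symm⟩
  -- Multiplication by `u` preserves two properties that separate the types: being a unit, and being
  -- killed by `p^i`. Type 1 has only units; the nonunits of `X` are killed by `p^i` in type 2 and
  -- not in type 3.
  have hunit : ∀ {a b : CyclicBrace p n i}, toZMod b = u * toZMod a →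
      (IsUnit (toZMod b) ↔ IsUnit (toZMod a)) := fun hab => by
    rw [hab, IsUnit.mul_iff, and_iff_right hu]
  have hzero : ∀ {a b : CyclicBrace p n i}, toZMod b = u * toZMod a →
      ((p : ZMod (p ^ n)) ^ i * toZMod b = 0 ↔ (p : ZMod (p ^ n)) ^ i * toZMod a = 0) :=
    fun hab => by rw [hab, mul_left_comm, hu.mul_right_eq_zero]
  rcases hD with hD | hD | hD
  · have hX := isUnit_of_mem_X_of_isType1 hn hD
    have hX' : ∀ b ∈ D'.X, IsUnit (toZMod b) := fun b hb => by
      obtain ⟨a, ha, hab⟩ := h2 b hb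
      exact (hunit hab).mpr (hX a ha)
    rcases hD' with hD' | hD' | hD'
    · exact Or.inl ⟨hD, hD'⟩
    · obtain ⟨b, hb, hbu, -⟩ := nonunits_of_isType2 hn hin hD'
      exact absurd (hX' b hb) hbu
    · obtain ⟨b, hb, hbu⟩ := (nonunits_of_isType3 hn hD').1
      exact absurd (hX' b hb) hbu
  · obtain ⟨a, ha, hau, ha0⟩ := nonunits_of_isType2 hn hin hD
    obtain ⟨b, hb, hab⟩ := h1 a ha
    rw [← hunit hab] at hau
    rw [← hzero hab] at ha0
    rcases hD' with hD' | hD' | hD'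
    · exact absurd (isUnit_of_mem_X_of_isType1 hn hD' b hb) hau
    · exact Or.inr (Or.inl ⟨hD, hD'⟩)
    · exact absurd ha0 ((nonunits_of_isType3 hn hD').2 b hb hau)
  · obtain ⟨⟨a, ha, hau⟩, hX⟩ := nonunits_of_isType3 hn hD
    rcases hD' with hD' | hD' | hD'
    · obtain ⟨b, hb, hab⟩ := h1 a ha
      exact absurd (isUnit_of_mem_X_of_isType1 hn hD' b hb) ((hunit hab).not.mpr hau)
    · obtain ⟨b, hb, hbu, hb0⟩ := nonunits_of_isType2 hn hin hD'
      obtain ⟨c, hc, hbc⟩ := h2 b hb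
      exact absurd ((hzero hbc).mp hb0) (hX c hc ((hunit hbc).not.mp hbu))
    · exact Or.inr (Or.inr ⟨hD, hD'⟩)

/-- Multiplication by `1 + p^(n-i) k` is a brace automorphism preserving units and the socle, so it
matches the orbits together with their subgroups, and `Datum.isomorphic_of_map_eq` applies. -/
theorem isomorphic_of_isUnit (hn : 0 < n) (hin : i ≤ n) {D D' : Datum.{0, v} (CyclicBrace p n i)}
    (hD : (IsUnitSingle D ∧ IsUnitSingle D') ∨ (IsUnitPair D ∧ IsUnitPair D'))
    {k : ZMod (p ^ n)} (h : toZMod '' D'.X =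
      (fun a => (1 + (p : ZMod (p ^ n)) ^ (n - i) * k) * a) '' (toZMod '' D.X)) :
    Isomorphic D.solution D'.solution := by
  obtain ⟨b, hb, hbu⟩ := (closure_eq_top_iff hn _).mp D'.generates
  have hb' : toZMod b ∈ toZMod '' D'.X := ⟨b, hb, rfl⟩
  rw [h] at hb'
  obtain ⟨_, -, hab⟩ := hb'
  -- For `i = n` the factor is not a unit by its form. It is one here because it divides a unit of
  -- `D'.X`.
  have hu : IsUnit (1 + (p : ZMod (p ^ n)) ^ (n - i) * k) :=
    (IsUnit.mul_iff.mp (hab ▸ hbu)).1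
  obtain ⟨u, hu'⟩ := hu
  rw [← hu'] at h
  let f : CyclicBrace p n i ≃ CyclicBrace p n i := toZMod.trans (u.mulLeft.trans toZMod.symm)
  have hf : ∀ x, toZMod (f x) = u * toZMod x := fun x => rfl
  let μ : CyclicBrace p n i ≃* CyclicBrace p n i :=
    MulEquiv.mk f ((unit_mul_map_mul_iff hin f u hf).mpr ⟨k, hu'⟩)
  have hμ : ∀ x, toZMod (μ x) = u * toZMod x := hf
  have hadd : ∀ a b, μ (a + b) = μ a + μ b := fun a b => by
    apply toZMod.injective
    rw [toZMod_add, hμ, hμ, hμ, toZMod_add, mul_add]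
  have hμu : ∀ a, IsUnit (toZMod (μ a)) ↔ IsUnit (toZMod a) := fun a => by
    rw [hμ, IsUnit.mul_iff, and_iff_right u.isUnit]
  have hμX : ∀ q : Σ i, D.J i, ∃ q' : Σ i, D'.J i, μ (D.x q.1) ∈ orbit (D'.x q'.1) := by
    intro q
    have h1 : toZMod (μ (D.x q.1)) ∈ toZMod '' D'.X :=
      h ▸ ⟨_, ⟨_, Set.mem_iUnion.mpr ⟨q.1, mem_orbit_self _⟩, rfl⟩, rfl⟩
    obtain ⟨c, hc, hcq⟩ := h1
    obtain ⟨j, hj⟩ := Set.mem_iUnion.mp (toZMod.injective hcq ▸ hc)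
    obtain ⟨l⟩ := D'.nonempty_J j
    exact ⟨⟨j, l⟩, hj⟩
  rcases hD with ⟨⟨q, hq, -, hK⟩, ⟨q', hq', -, hK'⟩⟩ |
    ⟨⟨q₁, q₂, hq, hnu, hK₁, hu, hK₂⟩, ⟨q₁', q₂', hq', hnu', hK₁', hu', hK₂'⟩⟩
  · let e : (Σ i, D.J i) ≃ (Σ i, D'.J i) :=
      ⟨fun _ => q', fun _ => q, fun a => (hq a).symm, fun a => (hq' a).symm⟩
    refine Datum.isomorphic_of_map_eq mul_comm' μ hadd e (fun a x => ?_) fun a => ?_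
    · obtain rfl := hq a
      change _ ↔ μ x ∈ D'.K q'.1 q'.2
      rw [hK, hK', Subgroup.mem_bot, Subgroup.mem_bot, MulEquiv.map_eq_one_iff]
    · obtain ⟨c, hc⟩ := hμX a
      obtain rfl := hq' c
      exact hc
  · classical
    have hne : q₂ ≠ q₁ := by rintro rfl; exact hnu hu
    have hne' : q₂' ≠ q₁' := by rintro rfl; exact hnu' hu'
    let e : (Σ i, D.J i) ≃ (Σ i, D'.J i) :=
      { toFun := fun a => if a = q₁ then q₁' else q₂'
        invFun := fun a => if a = q₁' then q₁ else q₂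
        left_inv := fun a => by rcases hq a with rfl | rfl <;> simp [hne, hne']
        right_inv := fun a => by rcases hq' a with rfl | rfl <;> simp [hne, hne'] }
    have he₁ : e q₁ = q₁' := if_pos rfl
    have he₂ : e q₂ = q₂' := if_neg hne
    refine Datum.isomorphic_of_map_eq mul_comm' μ hadd e (fun a x => ?_) fun a => ?_
    · rcases hq a with rfl | rfl
      · rw [he₁, hK₁, hK₁', Subgroup.mem_bot, Subgroup.mem_bot, MulEquiv.map_eq_one_iff]
      · rw [he₂, hK₂, hK₂', mem_socle_iff, mem_socle_iff, hμ, mul_left_comm,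
          Units.mul_right_eq_zero]
    · obtain ⟨c, hc⟩ := hμX a
      -- Being a unit or not decides which of the two orbits of `D'` receives the image.
      have h1 := isUnit_iff_of_mem_orbit hc
      rw [hμu] at h1
      rcases hq a with rfl | rfl
      · rw [he₁]
        rcases hq' c with rfl | rfl
        exacts [hc, absurd (h1.mpr hu') hnu]
      · rw [he₂]
        rcases hq' c with rfl | rfl
        exacts [absurd (h1.mp hu) hnu', hc]

theorem isomorphic_iff (hn : 0 < n) (hin : i ≤ n) (D D' : Datum.{0, v} (CyclicBrace p n i))
    (hD : IsType1 D ∨ IsType2 D ∨ IsType3 D) (hD' : IsType1 D' ∨ IsType2 D' ∨ IsType3 D') :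
    Isomorphic D.solution D'.solution ↔
      ((IsType1 D ∧ IsType1 D') ∨ (IsType2 D ∧ IsType2 D') ∨ (IsType3 D ∧ IsType3 D')) ∧
      ∃ k : ZMod (p ^ n), toZMod '' D'.X =
        (fun a => (1 + (p : ZMod (p ^ n)) ^ (n - i) * k) * a) '' (toZMod '' D.X) := by
  constructor
  · intro h
    obtain ⟨μ, hμ, hX⟩ := Datum.exists_mulEquiv_of_isomorphic h
    obtain ⟨u, hu⟩ := exists_unit_of_map_add μ.toEquiv hμ
    obtain ⟨k, hk⟩ := (unit_mul_map_mul_iff hin μ.toEquiv u hu).mp μ.map_mul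
    have h1 : toZMod '' D'.X = (fun a => (u : ZMod (p ^ n)) * a) '' (toZMod '' D.X) := by
      rw [← hX, Set.image_image, Set.image_image]
      exact Set.image_congr fun a _ => hu a
    exact ⟨isType_of_image_X hn hin hD hD' u.isUnit h1, k, hk ▸ h1⟩
  · rintro ⟨h, k, hk⟩
    refine isomorphic_of_isUnit hn hin ?_ hk
    rw [isUnitSingle_iff hn hin, isUnitSingle_iff hn hin, isUnitPair_iff hn hin,
      isUnitPair_iff hn hin]
    tauto

end CyclicBrace

/-! ### The classification. -/

theorem mainTheorem4 (p n i : ℕ) (hp : p.Prime) (hn : 3 ≤ n) [NeZero i] (hin : i ≤ n)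
    (h2 : p = 2 → 2 ≤ i) :
    -- the multiplicative group of `G_i` is cyclic of order `p^n`
    (IsCyclic (CyclicBrace p n i) ∧ Nat.card (CyclicBrace p n i) = p ^ n) ∧
    -- the socle is `⟨p^(n-i)⟩`, both additively and multiplicatively, and is isomorphic to
    -- `ℤ/(p^i)` (for both operations)
    ((LeftBrace.socle (CyclicBrace p n i) : Set (CyclicBrace p n i)) =
        AddSubgroup.zmultiples (CyclicBrace.socGen p n i) ∧
      LeftBrace.socle (CyclicBrace p n i) = CyclicBrace.socSubgroup p n i ∧
      ∃ e : LeftBrace.socle (CyclicBrace p n i) ≃ ZMod (p ^ i),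
        (∀ x y, e (x * y) = e x + e y) ∧
        ∀ x y z : LeftBrace.socle (CyclicBrace p n i),
          (z : CyclicBrace p n i) = x + y → e z = e x + e y) ∧
    -- brace automorphisms are the multiplications by the units `1 + p^(n-i) k`
    (∃ F : LeftBrace.braceAut (CyclicBrace p n i) →* (ZMod (p ^ n))ˣ,
      Function.Injective F ∧
      (∀ f x, CyclicBrace.toZMod (f.1 x) = (F f : ZMod (p ^ n)) * CyclicBrace.toZMod x) ∧
      (i < n → (Set.range fun f => (F f : ZMod (p ^ n))) =
        {a | ∃ k : ZMod (p ^ n), a = 1 + (p : ZMod (p ^ n)) ^ (n - i) * k}) ∧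
      (i = n → Function.Surjective F)) ∧
    -- for `i = n` these are all the additive automorphisms
    (i = n → (∀ f : AddAut (CyclicBrace p n i), ∀ x y, f (x * y) = f x * f y) ∧
      Nonempty (Multiplicative (AddAut (CyclicBrace p n i)) ≃* (ZMod (p ^ n))ˣ)) ∧
    -- the action `lam`, its orbits, their cardinalities and the stabilizers of their elements
    (∀ x a : CyclicBrace p n i, CyclicBrace.toZMod (LeftBrace.lam x a) =
      (1 + (p : ZMod (p ^ n)) ^ i * CyclicBrace.toZMod x) * CyclicBrace.toZMod a) ∧
    (∀ S : Set (CyclicBrace p n i), (∃ a, S = LeftBrace.orbit a) ↔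
      (∃ α, CyclicBrace.IsParam1 p i α ∧ S = CyclicBrace.X1 p n i α) ∨
      (∃ β k, CyclicBrace.IsParam2 p n i β k ∧ S = CyclicBrace.X2 p n i β k) ∨
      (∃ γ, CyclicBrace.IsParam3 p i γ ∧ S = CyclicBrace.X3 p n i γ)) ∧
    (∀ α, CyclicBrace.IsParam1 p i α →
      (CyclicBrace.X1 p n i α).ncard = p ^ (n - i) ∧
      ∀ a ∈ CyclicBrace.X1 p n i α, ∀ H : Subgroup (CyclicBrace p n i),
        Nat.card H = p ^ i ↔ H = LeftBrace.stab a) ∧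
    (∀ β k, CyclicBrace.IsParam2 p n i β k →
      (CyclicBrace.X2 p n i β k).ncard = p ^ (n - i - k) ∧
      ∀ a ∈ CyclicBrace.X2 p n i β k, ∀ H : Subgroup (CyclicBrace p n i),
        Nat.card H = p ^ (i + k) ↔ H = LeftBrace.stab a) ∧
    (∀ γ, CyclicBrace.IsParam3 p i γ →
      ∀ a ∈ CyclicBrace.X3 p n i γ, LeftBrace.stab a = ⊤) ∧
    -- basic data are exactly those of the three types
    (∀ D : YangBaxter.Datum.{0, w} (CyclicBrace p n i), D.IsBasic ↔
      CyclicBrace.IsType1 D ∨ CyclicBrace.IsType2 D ∨ CyclicBrace.IsType3 D) ∧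
    -- for all admissible parameters the data of the three types exist
    (∀ α, CyclicBrace.IsParam1 p i α →
      (∃ D : YangBaxter.Datum.{0, w} (CyclicBrace p n i),
        D.IsSingle (CyclicBrace.X1 p n i α) ⊥) ∧
      (∀ γ, CyclicBrace.IsParam3 p i γ → (i = n → p ∣ γ) →
        ∃ D : YangBaxter.Datum.{0, w} (CyclicBrace p n i),
          D.IsPair (CyclicBrace.X3 p n i γ) ⊥
            (CyclicBrace.X1 p n i α) (CyclicBrace.socSubgroup p n i)) ∧
      (∀ β k, CyclicBrace.IsParam2 p n i β k →
        ∃ D : YangBaxter.Datum.{0, w} (CyclicBrace p n i),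
          D.IsPair (CyclicBrace.X2 p n i β k) ⊥
            (CyclicBrace.X1 p n i α) (CyclicBrace.socSubgroup p n i))) ∧
    -- basic solutions are exactly those given by data of the three types
    (∀ (Z : Type w) (t : Z × Z → Z × Z),
      YangBaxter.IsBasicSolution (CyclicBrace p n i) t ↔
        ∃ D : YangBaxter.Datum.{0, w} (CyclicBrace p n i),
          (CyclicBrace.IsType1 D ∨ CyclicBrace.IsType2 D ∨ CyclicBrace.IsType3 D) ∧
          YangBaxter.Isomorphic t D.solution) ∧
    -- the isomorphism criterion
    (∀ D D' : YangBaxter.Datum.{0, w} (CyclicBrace p n i),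
      (CyclicBrace.IsType1 D ∨ CyclicBrace.IsType2 D ∨ CyclicBrace.IsType3 D) →
      (CyclicBrace.IsType1 D' ∨ CyclicBrace.IsType2 D' ∨ CyclicBrace.IsType3 D') →
      (YangBaxter.Isomorphic D.solution D'.solution ↔
        ((CyclicBrace.IsType1 D ∧ CyclicBrace.IsType1 D') ∨
          (CyclicBrace.IsType2 D ∧ CyclicBrace.IsType2 D') ∨
          (CyclicBrace.IsType3 D ∧ CyclicBrace.IsType3 D')) ∧
        ∃ k : ZMod (p ^ n), CyclicBrace.toZMod '' D'.X =
          (fun a => (1 + (p : ZMod (p ^ n)) ^ (n - i) * k) * a) '' (CyclicBrace.toZMod '' D.X))) := by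
  have : Fact p.Prime := ⟨hp⟩
  have hn0 : 0 < n := by omega
  refine ⟨⟨CyclicBrace.isCyclic hn0 h2, CyclicBrace.card_eq⟩,
    ⟨CyclicBrace.coe_socle_eq_zmultiples hin, CyclicBrace.socle_eq_socSubgroup hin,
      CyclicBrace.exists_socle_equiv hin⟩,
    CyclicBrace.exists_braceAut_hom hin,
    fun h => ⟨CyclicBrace.map_mul_of_eq h, CyclicBrace.nonempty_addAut_mulEquiv⟩,
    CyclicBrace.toZMod_lam,
    CyclicBrace.exists_eq_orbit_iff hn0 hin,
    fun α hα => CyclicBrace.X1_ncard_and_stab hn0 hin h2 hα,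
    fun β k hβ => CyclicBrace.X2_ncard_and_stab hn0 h2 hβ,
    fun γ _ a ha => CyclicBrace.stab_eq_top_of_mem_X3 hin ha,
    CyclicBrace.isBasic_iff_isType hn0 hin h2,
    fun α hα => ?_, fun Z t => ?_, CyclicBrace.isomorphic_iff hn0 hin⟩
  · have hu := (CyclicBrace.isUnit_natCast_iff (p := p) hn0 α).mpr hα.2.2
    rw [← CyclicBrace.orbit_eq_X1 hn0 hα]
    refine ⟨CyclicBrace.exists_isSingle hn0 hu, fun γ _ hγ => ?_, fun β k hβ => ?_⟩
    · rw [← CyclicBrace.orbit_eq_X3 hin]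
      exact CyclicBrace.exists_isPair hn0 hin
        (CyclicBrace.not_isUnit_of_mem_X3 hn0 hγ hin rfl) hu
    · rw [← CyclicBrace.orbit_eq_X2 hn0 hβ]
      refine CyclicBrace.exists_isPair hn0 hin
        (CyclicBrace.not_isUnit_of_mem_X2 hn0 hβ ?_) hu
      rw [← CyclicBrace.orbit_eq_X2 hn0 hβ]
      exact CyclicBrace.mem_orbit_self _
  · constructor
    · rintro ⟨-, D, hD, h⟩
      exact ⟨D, (CyclicBrace.isBasic_iff_isType hn0 hin h2 D).mp hD, h⟩
    · rintro ⟨D, hD, h⟩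
      -- The solution property and the permutation brace come for free from any datum over `G_i`, so
      -- only basicness distinguishes the types.
      exact ⟨D.exists_permutationBraceIso h, D,
        (CyclicBrace.isBasic_iff_isType hn0 hin h2 D).mpr hD, h⟩
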